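/- **Setting.** A weighted hypergraph $H=(V,E,w)$ has a finite vertex set $V$ with $|V|=n$, finitely many hyperedges $e\in E$ with at least two vertices each (parallel hyperedges are allowed), and weights $w(e)\ge 0$. Its energy is $Q_H(x)=\sum_{e\in E}w(e)\max_{u,v\in e}(x_u-x_v)^2$ for $x\in\mathbb R^V$. A reweighting $\widetilde H=(V,E,\widetilde w)$ of $H$ with $\widetilde w\ge 0$ (hyperedges of weight $0$ are deleted) is an $\epsilon$-spectral sparsifier of $H$ if $(1-\epsilon)Q_H(x)\le Q_{\widetilde H}(x)\le(1+\epsilon)Q_H(x)$ for all $x\in\mathbb R^V$. For $e\in E$ let $F_e$ be the edge set of the clique on $e$. A weight assignment of $H$ is a weighted multigraph $G=(V,F,\mathbf w)$, where $F$ is the multiset union of the sets $F_e$, $e\in E$, $\mathbf w\ge 0$, and $\sum_{f\in F_e}\mathbf w(f)=w(e)$ for all $e\in E$. Let $L_G$ be the Laplacian of $G$, and for $f=\{u,v\}$ let $R_G(f)=(\chi_u-\chi_v)^\top L_G^{+}(\chi_u-\chi_v)$ be the effective resistance, where $L_G^+$ is the Moore–Penrose inverse and $\chi_u$ is the indicator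 vector of $u$. The weight assignment is $\eta$-approximate $\gamma$-balanced if for every $e\in E$ $$\gamma\cdot\min_{g\in F_e:\ \mathbf w(g)\ge\eta\, w(e)}R_G(g)\ \ge\ \max_{f\in F_e}R_G(f).$$ **Lemma.** There is an absolute constant $c>0$, and for every $\gamma\ge 4$ there is a constant $K=K(\gamma)>0$, such that the following holds. Let $H=(V,E,w)$ be a weighted hypergraph on $n$ vertices, and let $G=(V,F,\mathbf w)$ be a $1/n^2$-approximate $\gamma$-balanced weight assignment of $H$ such that $G$ is connected (through its edges of positive weight). Let $1/n\le\epsilon<1$ and $\lambda\ge c\,\log^3(n)/\epsilon^4$. Sample each hyperedge $e\in E$ independently with probability $$p(e)=\min\Bigl(1,\ \lambda\cdot w(e)\cdot\max_{f\in F_e}R_G(f)\Bigr),$$ and give it the weight $\widetilde w(e)=w(e)/p(e)$ if it is sampled and $\widetilde w(e)=0$ otherwise. Then, with probability at least $1-K\log(n)/n$, the resulting hypergraph $\widetilde H=(V,E,\widetilde w)$ is an $\epsilon$-spectral sparsifier of $H$. -/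

import Mathlib

open Matrix MeasureTheory ProbabilityTheory
open scoped NNReal

namespace HypergraphSparsification

noncomputable section

/-! ### Weighted multigraphs, Laplacians, effective resistance -/

/-- A finite weighted undirected multigraph without loops on the vertex set `V`, whose edges are
indexed by `F` (so parallel edges are allowed). Weights are nonnegative; an edge of weight `0`
has no effect on the Laplacian. -/
structure WeightedGraph (V F : Type*) where
  ends : F → Sym2 V
  loopless : ∀ f, ¬ (ends f).IsDiag
  weight : F → ℝ
  weight_nonneg : ∀ f, 0 ≤ weight f

namespace WeightedGraph

/-- The simple graph spanned by the edges of positive weight. -/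
def support {V F : Type*} (G : WeightedGraph V F) : SimpleGraph V :=
  SimpleGraph.fromEdgeSet {s | ∃ f, G.ends f = s ∧ 0 < G.weight f}

/-- Connectedness of a weighted graph; edges of weight `0` do not connect anything. -/
def Connected {V F : Type*} (G : WeightedGraph V F) : Prop := G.support.Connected

/-- The Laplacian: weighted degrees on the diagonal, and minus the total weight of the (parallel)
edges between `u` and `v` in the entry `(u, v)`. -/
def laplacian {V F : Type*} [DecidableEq V] [Fintype F] (G : WeightedGraph V F) : Matrix V V ℝ :=
  Matrix.of fun u v =>
    if u = v then ∑ f with u ∈ G.ends f, G.weight f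
    else - ∑ f with G.ends f = s(u, v), G.weight f

end WeightedGraph

/-- The four Penrose equations for real matrices. -/
structure IsMoorePenroseInverse {V : Type*} [Fintype V] (A B : Matrix V V ℝ) : Prop where
  mul_mul_left : A * B * A = A
  mul_mul_right : B * A * B = B
  transpose_left : (A * B)ᵀ = A * B
  transpose_right : (B * A)ᵀ = B * A

theorem IsMoorePenroseInverse.unique {V : Type*} [Fintype V] {A B C : Matrix V V ℝ}
    (hB : IsMoorePenroseInverse A B) (hC : IsMoorePenroseInverse A C) : B = C := by
  have h1 : A * B = A * C := by
    calc A * B = (A * C * A) * B := by rw [hC.mul_mul_left]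
      _ = (A * C)ᵀ * (A * B)ᵀ := by
        rw [hC.transpose_left, hB.transpose_left]; simp only [Matrix.mul_assoc]
      _ = (A * B * A * C)ᵀ := by
        rw [← Matrix.transpose_mul]; simp only [Matrix.mul_assoc]
      _ = A * C := by rw [hB.mul_mul_left, hC.transpose_left]
  have h2 : B * A = C * A := by
    calc B * A = B * (A * C * A) := by rw [hC.mul_mul_left]
      _ = (B * A)ᵀ * (C * A)ᵀ := by
        rw [hC.transpose_right, hB.transpose_right]; simp only [Matrix.mul_assoc]
      _ = (C * (A * B * A))ᵀ := by
        rw [← Matrix.transpose_mul]; simp only [Matrix.mul_assoc]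
      _ = C * A := by rw [hB.mul_mul_left, hC.transpose_right]
  calc B = B * A * B := hB.mul_mul_right.symm
    _ = C * A * B := by rw [h2]
    _ = C * (A * B) := Matrix.mul_assoc _ _ _
    _ = C * (A * C) := by rw [h1]
    _ = C * A * C := (Matrix.mul_assoc _ _ _).symm
    _ = C := hC.mul_mul_right

/-- Every symmetric real matrix has a Moore-Penrose inverse. -/
theorem exists_isMoorePenroseInverse {V : Type*} [Fintype V] [DecidableEq V]
    {A : Matrix V V ℝ} (hA : A.IsHermitian) : ∃ B, IsMoorePenroseInverse A B := by
  obtain ⟨U, d, hU, hAU⟩ : ∃ (U : Matrix V V ℝ) (d : V → ℝ), Uᵀ * U = 1 ∧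
      A = U * diagonal d * Uᵀ := by
    refine ⟨hA.eigenvectorUnitary, hA.eigenvalues, ?_, ?_⟩
    · have := Unitary.coe_star_mul_self hA.eigenvectorUnitary
      simpa [Matrix.star_eq_conjTranspose, Matrix.conjTranspose_eq_transpose_of_trivial] using this
    · have := hA.spectral_theorem
      simpa [Unitary.conjStarAlgAut_apply, Matrix.star_eq_conjTranspose,
        Matrix.conjTranspose_eq_transpose_of_trivial, Function.comp_def] using this
  have key : ∀ a b : V → ℝ, (U * diagonal a * Uᵀ) * (U * diagonal b * Uᵀ) =
      U * diagonal (fun i => a i * b i) * Uᵀ := by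
    intro a b
    calc (U * diagonal a * Uᵀ) * (U * diagonal b * Uᵀ)
        = U * diagonal a * (Uᵀ * U) * diagonal b * Uᵀ := by simp only [Matrix.mul_assoc]
      _ = _ := by rw [hU, Matrix.mul_one, Matrix.mul_assoc U, diagonal_mul_diagonal]
  have tr : ∀ a : V → ℝ, (U * diagonal a * Uᵀ)ᵀ = U * diagonal a * Uᵀ := by
    intro a
    rw [Matrix.transpose_mul, Matrix.transpose_mul, Matrix.transpose_transpose,
      Matrix.diagonal_transpose, Matrix.mul_assoc]
  refine ⟨U * diagonal (fun i => (d i)⁻¹) * Uᵀ, ?_, ?_, ?_, ?_⟩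
  · rw [hAU, key, key]
    simp only [mul_inv_mul_cancel]
  · rw [hAU, key, key]
    have h : ∀ x : ℝ, x⁻¹ * x * x⁻¹ = x⁻¹ := fun x => by
      simpa only [inv_inv] using mul_inv_mul_cancel x⁻¹
    simp only [h]
  · rw [hAU, key, tr]
  · rw [hAU, key, tr]

open Classical in
/-- The Moore-Penrose inverse, as the unique solution of the Penrose equations. -/
def pinv {V : Type*} [Fintype V] (A : Matrix V V ℝ) : Matrix V V ℝ :=
  if h : ∃ B, IsMoorePenroseInverse A B then h.choose else 0

namespace WeightedGraph

theorem laplacian_isHermitian {V F : Type*} [DecidableEq V] [Fintype F] (G : WeightedGraph V F) :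
    G.laplacian.IsHermitian := by
  ext u v
  by_cases h : u = v
  · subst h; simp [laplacian]
  · simp [laplacian, h, Ne.symm h, Sym2.eq_swap (a := u)]

variable {V F : Type*} [Fintype V] [DecidableEq V] [Fintype F]

/-- The pseudo-inverse of a Laplacian is a genuine Moore-Penrose inverse. -/
theorem isMoorePenroseInverse_pinv_laplacian (G : WeightedGraph V F) :
    IsMoorePenroseInverse G.laplacian (pinv G.laplacian) := by
  have h := exists_isMoorePenroseInverse G.laplacian_isHermitian
  rw [pinv, dif_pos h]
  exact h.choose_spec

/-- The vector `χ_u - χ_v`. -/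
def chiDiff (u v : V) : V → ℝ := Pi.single u 1 - Pi.single v 1

/-- The effective resistance `R_G(u, v) = (χ_u - χ_v)ᵀ L_G⁺ (χ_u - χ_v)`. -/
def effRes (G : WeightedGraph V F) (u v : V) : ℝ :=
  chiDiff u v ⬝ᵥ (pinv G.laplacian *ᵥ chiDiff u v)

/-- The quadratic form of the Laplacian is `∑ w(f) · (x_u - x_v)²` over the edges `f = {u, v}`. -/
theorem dotProduct_laplacian_mulVec (G : WeightedGraph V F) (x : V → ℝ) :
    x ⬝ᵥ (G.laplacian *ᵥ x) = ∑ f, G.weight f *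
      Sym2.lift ⟨fun u v => (x u - x v) ^ 2, fun _ _ => by ring⟩ (G.ends f) := by
  have entry : ∀ u v, G.laplacian u v = ∑ f, G.weight f *
      (if u = v then (if u ∈ G.ends f then 1 else 0)
        else - (if G.ends f = s(u, v) then 1 else 0)) := by
    intro u v
    by_cases h : u = v
    · simp [laplacian, h, Finset.sum_filter]
    · simp [laplacian, h, Finset.sum_filter]
  have hf : ∀ f, Sym2.lift ⟨fun u v => (x u - x v) ^ 2, fun _ _ => by ring⟩ (G.ends f) =
      ∑ u, ∑ v, x u * (if u = v then (if u ∈ G.ends f then 1 else 0)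
        else - (if G.ends f = s(u, v) then 1 else 0)) * x v := by
    intro f
    have hl := G.loopless f
    generalize G.ends f = s at hl
    induction s with
    | _ a b =>
      have hab : a ≠ b := by simpa using hl
      have hB : ∀ u v, (if u = v then (if u ∈ s(a, b) then (1 : ℝ) else 0)
          else - (if s(a, b) = s(u, v) then 1 else 0)) = chiDiff a b u * chiDiff a b v := by
        intro u v
        simp only [chiDiff, Pi.sub_apply, Pi.single_apply, Sym2.mem_iff, Sym2.eq_iff]
        grind
      have hc : ∑ u, x u * chiDiff a b u = x a - x b := by
        simp [chiDiff, mul_sub, Finset.sum_sub_distrib, Pi.single_apply]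
      simp only [hB]
      calc (x a - x b) ^ 2 = (∑ u, x u * chiDiff a b u) * ∑ v, x v * chiDiff a b v := by
            rw [hc]; ring
        _ = _ := by
            rw [Finset.sum_mul_sum]
            refine Finset.sum_congr rfl fun u _ => Finset.sum_congr rfl fun v _ => by ring
  simp only [hf, dotProduct, mulVec, entry, Finset.mul_sum, Finset.sum_mul]
  rw [Finset.sum_comm (s := (Finset.univ : Finset F))]
  refine Finset.sum_congr rfl fun u _ => ?_
  rw [Finset.sum_comm (s := (Finset.univ : Finset F))]
  exact Finset.sum_congr rfl fun v _ => Finset.sum_congr rfl fun f _ => by ring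

theorem effRes_nonneg (G : WeightedGraph V F) (u v : V) : 0 ≤ G.effRes u v := by
  have hB := G.isMoorePenroseInverse_pinv_laplacian
  have hL : G.laplacianᵀ = G.laplacian := by
    simpa [Matrix.IsHermitian, Matrix.conjTranspose_eq_transpose_of_trivial] using
      G.laplacian_isHermitian
  have hBt : (pinv G.laplacian)ᵀ = pinv G.laplacian := by
    refine IsMoorePenroseInverse.unique (A := G.laplacian) ⟨?_, ?_, ?_, ?_⟩ hB
    · simpa [hL, Matrix.mul_assoc] using congrArg Matrix.transpose hB.mul_mul_left
    · simpa [hL, Matrix.mul_assoc] using congrArg Matrix.transpose hB.mul_mul_right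
    · have := hB.transpose_right
      rw [Matrix.transpose_mul, hL] at this
      rw [this, ← this, Matrix.transpose_mul, hL, Matrix.transpose_transpose, this]
    · have := hB.transpose_left
      rw [Matrix.transpose_mul, hL] at this
      rw [this, ← this, Matrix.transpose_mul, hL, Matrix.transpose_transpose, this]
  have key : G.effRes u v = (pinv G.laplacian *ᵥ chiDiff u v) ⬝ᵥ
      (G.laplacian *ᵥ (pinv G.laplacian *ᵥ chiDiff u v)) := by
    rw [effRes]
    conv_lhs => rw [← hB.mul_mul_right, ← Matrix.mulVec_mulVec, ← Matrix.mulVec_mulVec,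
      Matrix.dotProduct_mulVec, ← Matrix.mulVec_transpose, hBt]
  rw [key, dotProduct_laplacian_mulVec]
  refine Finset.sum_nonneg fun f _ => mul_nonneg (G.weight_nonneg f) ?_
  induction G.ends f with
  | _ a b => exact sq_nonneg _

theorem effRes_comm (G : WeightedGraph V F) (u v : V) : G.effRes u v = G.effRes v u := by
  have h : chiDiff u v = - chiDiff v u := by simp [chiDiff]
  simp [effRes, h, Matrix.mulVec_neg]

/-- The effective resistance `R_G(f) = R_G(u, v)` of an unordered pair `f = {u, v}`. -/
def effResPair (G : WeightedGraph V F) : Sym2 V → ℝ :=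
  Sym2.lift ⟨G.effRes, G.effRes_comm⟩

theorem effResPair_nonneg (G : WeightedGraph V F) (f : Sym2 V) : 0 ≤ G.effResPair f := by
  induction f with
  | _ u v => exact G.effRes_nonneg u v

end WeightedGraph

/-! ### Weighted hypergraphs and spectral sparsifiers -/

/-- A finite weighted hypergraph on the vertex set `V`, whose hyperedges are indexed by `E`.
Hyperedges have at least two vertices and nonnegative weights. -/
structure WeightedHypergraph (V E : Type*) where
  edge : E → Finset V
  two_le_card : ∀ e, 2 ≤ (edge e).card
  weight : E → ℝ
  weight_nonneg : ∀ e, 0 ≤ weight e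

/-- The edge set of the clique on a vertex set `s`: all unordered pairs of distinct vertices. -/
def cliqueEdges {V : Type*} [DecidableEq V] (s : Finset V) : Finset (Sym2 V) :=
  s.sym2.filter fun f => ¬ f.IsDiag

theorem cliqueEdges_nonempty {V : Type*} [DecidableEq V] {s : Finset V} (hs : 2 ≤ s.card) :
    (cliqueEdges s).Nonempty := by
  obtain ⟨u, hu, v, hv, huv⟩ := Finset.one_lt_card.mp hs
  exact ⟨s(u, v), by simp [cliqueEdges, hu, hv, huv]⟩

namespace WeightedHypergraph

variable {V E : Type*}

theorem edge_product_nonempty (H : WeightedHypergraph V E) (e : E) :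
    (H.edge e ×ˢ H.edge e).Nonempty := by
  have h : (H.edge e).Nonempty := Finset.card_pos.mp (by have := H.two_le_card e; omega)
  exact h.product h

/-- The energy `Q_H(x) = ∑_e w(e) · max_{u, v ∈ e} (x_u - x_v)²`. -/
def energy [Fintype E] (H : WeightedHypergraph V E) (x : V → ℝ) : ℝ :=
  ∑ e, H.weight e *
    (H.edge e ×ˢ H.edge e).sup' (H.edge_product_nonempty e) fun p => (x p.1 - x p.2) ^ 2

/-- `H'` is an `ε`-spectral sparsifier of `H`: it is a reweighting of `H` (hyperedges of weight
`0` being regarded as deleted) whose energy is within a factor `1 ± ε` of that of `H`. -/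
def IsSpectralSparsifier [Fintype E] (H' H : WeightedHypergraph V E) (ε : ℝ) : Prop :=
  H'.edge = H.edge ∧
    ∀ x : V → ℝ, (1 - ε) * H.energy x ≤ H'.energy x ∧ H'.energy x ≤ (1 + ε) * H.energy x

variable [DecidableEq V]

/-- The disjoint union (multiset union) of the cliques `F_e` over all hyperedges `e`. -/
abbrev CliqueEdge (H : WeightedHypergraph V E) : Type _ :=
  Σ e : E, {f : Sym2 V // f ∈ cliqueEdges (H.edge e)}

/-- A weight assignment of `H`: nonnegative weights on all clique edges such that the weights of
the edges in `F_e` add up to `w(e)`. -/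
structure WeightAssignment (H : WeightedHypergraph V E) where
  weight : H.CliqueEdge → ℝ
  weight_nonneg : ∀ f, 0 ≤ weight f
  sum_weight : ∀ e, ∑ f : {f : Sym2 V // f ∈ cliqueEdges (H.edge e)}, weight ⟨e, f⟩ = H.weight e

namespace WeightAssignment

variable {H : WeightedHypergraph V E}

/-- The weighted multigraph `G = (V, F, 𝐰)` given by a weight assignment. -/
def graph (G : H.WeightAssignment) : WeightedGraph V H.CliqueEdge where
  ends f := f.2.1
  loopless f := (Finset.mem_filter.mp f.2.2).2
  weight := G.weight
  weight_nonneg := G.weight_nonneg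

variable [Fintype V] [Fintype E]

/-- `G` is an `η`-approximate `γ`-balanced weight assignment:
`γ · min {R_G(g) | g ∈ F_e, 𝐰(g) ≥ η · w(e)} ≥ max {R_G(f) | f ∈ F_e}` for every hyperedge `e`
(the minimum of the empty set being `+∞`). -/
def IsApproxBalanced (G : H.WeightAssignment) (η γ : ℝ) : Prop :=
  ∀ e, ∀ g : {g : Sym2 V // g ∈ cliqueEdges (H.edge e)}, η * H.weight e ≤ G.weight ⟨e, g⟩ →
    ∀ f ∈ cliqueEdges (H.edge e), G.graph.effResPair f ≤ γ * G.graph.effResPair g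

/-- `R^max(e) = max_{f ∈ F_e} R_G(f)`. -/
def maxRes (G : H.WeightAssignment) (e : E) : ℝ :=
  (cliqueEdges (H.edge e)).sup' (cliqueEdges_nonempty (H.two_le_card e)) G.graph.effResPair

theorem maxRes_nonneg (G : H.WeightAssignment) (e : E) : 0 ≤ G.maxRes e := by
  obtain ⟨f, hf⟩ := cliqueEdges_nonempty (H.two_le_card e)
  exact (G.graph.effResPair_nonneg f).trans (Finset.le_sup' G.graph.effResPair hf)

/-- The sampling probability `p(e) = min (1, w(e) · R^max(e) · λ)`. -/
def sampleProb (G : H.WeightAssignment) (lam : ℝ≥0) (e : E) : unitInterval :=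
  ⟨min 1 (H.weight e * G.maxRes e * lam),
    le_min zero_le_one (mul_nonneg (mul_nonneg (H.weight_nonneg e) (G.maxRes_nonneg e)) lam.2),
    min_le_left _ _⟩

/-- The output of the sampling algorithm when `s e` records whether the hyperedge `e` is
sampled: sampled hyperedges get weight `w(e) / p(e)`, all others are deleted (weight `0`). -/
def sparsification (G : H.WeightAssignment) (lam : ℝ≥0) (s : E → Bool) :
    WeightedHypergraph V E where
  edge := H.edge
  two_le_card := H.two_le_card
  weight e := if s e then H.weight e / G.sampleProb lam e else 0
  weight_nonneg e := by
    split_ifs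
    · exact div_nonneg (H.weight_nonneg e) (G.sampleProb lam e).2.1
    · exact le_rfl

/-- The law of the sampling outcomes: independently for each hyperedge `e`, the outcome is `true`
with probability `p(e)` and `false` with probability `1 - p(e)`. -/
def sampleLaw (G : H.WeightAssignment) (lam : ℝ≥0) : Measure (E → Bool) :=
  Measure.pi fun e => bernoulliMeasure true false (G.sampleProb lam e)

end WeightAssignment

end WeightedHypergraph

end

end HypergraphSparsification

/-! Map `x` to its weighted gradient `z` in `EuclideanSpace ℝ F`. Then `‖z‖²` is the Laplacian
energy of `x`, which is at most the hypergraph energy, so normalizing the energy to `1` puts `z` in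
the unit ball. Connectedness makes every difference `x u - x v` an inner product of `z` with a
vector of squared length `R(u, v)`. On a hyperedge with `0 < p(e) < 1`, the energy divided by
`R^max(e)` is therefore `h e z ^ 2`, with `h` at most `1` on the ball and `1`-Lipschitz for the
seminorm given by at most `n²` vectors of length at most `1`. As `p(e) = λ w(e) R^max(e)` there,
sparsification follows once `∑ (outcome - p) h²` is at most `ελ` uniformly over the `z` in the ball
with `∑ p h² ≤ λ` (`isSpectralSparsifier_of_concentration`).

Uniformity comes from slicing `h²` dyadically. At level `t` the slice takes values in `[0, t]`, so
Bernstein improves as `t` decreases, while the seminorm net needed, of radius `η√t`, has size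
`exp(O(log n / (η² t)))` in any dimension (`exists_net`). The two effects cancel: each level costs
an additive `O(log n / η³)` (`exists_bad_level`). Rounding to the net is charged to the level below
(`abs_dyadicPart_sq_sub_le`), so the rounding errors of all levels telescope to `O(η)` times the
total mass. That mass contains the deviation itself, with a small coefficient, and is absorbed
(`sampling_concentration`).

What lies below the lowest level is controlled by the number of sampled hyperedges. Its mean is `O(γ
n λ)`, by balancedness and Foster's theorem (`sum_weight_mul_maxRes_le`); balancedness enters
nowhere else. -/

namespace HypergraphSparsification

/-! ### Dimension-free nets of the unit ball for polyhedral seminorms, via Gaussian measure -/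

section GaussianCovering

open scoped ENNReal RealInnerProductSpace

/-- The unnormalized standard Gaussian density. -/
noncomputable def gaussianDensity {W : Type*} [NormedAddCommGroup W] (x : W) : ℝ≥0∞ :=
  ENNReal.ofReal (Real.exp (-‖x‖ ^ 2 / 2))

theorem measurable_gaussianDensity {W : Type*} [NormedAddCommGroup W] [MeasurableSpace W]
    [BorelSpace W] : Measurable (gaussianDensity : W → ℝ≥0∞) := by
  unfold gaussianDensity
  fun_prop

variable {W : Type*} [NormedAddCommGroup W] [InnerProductSpace ℝ W] [FiniteDimensional ℝ W]
  [MeasurableSpace W] [BorelSpace W]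

variable (W) in
/-- The unnormalized standard Gaussian measure. -/
noncomputable def gaussianMeasure : Measure W := volume.withDensity gaussianDensity

theorem gaussianMeasure_apply {S : Set W} (hS : MeasurableSet S) :
    gaussianMeasure W S = ∫⁻ y, S.indicator 1 y * gaussianDensity y := by
  rw [gaussianMeasure, withDensity_apply _ hS, ← lintegral_indicator hS]
  refine lintegral_congr fun y => ?_
  by_cases hy : y ∈ S <;> simp [hy]

theorem gaussianMeasure_univ : gaussianMeasure W Set.univ = ∫⁻ y : W, gaussianDensity y := by
  simp [gaussianMeasure]

theorem gaussianMeasure_univ_ne_top : gaussianMeasure W Set.univ ≠ ∞ := by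
  rw [gaussianMeasure_univ]
  have h := GaussianFourier.integrable_cexp_neg_mul_sq_norm_add (V := W) (b := 1 / 2)
    (by norm_num) 0 0
  have h2 := h.norm.lintegral_lt_top
  refine ne_of_lt (lt_of_eq_of_lt (lintegral_congr fun y => ?_) h2)
  rw [gaussianDensity, Complex.norm_exp]
  congr 2
  simp only [zero_mul, add_zero, ← Complex.ofReal_pow]
  rw [show (-(1 / 2 : ℂ)) = ((-(1 / 2) : ℝ) : ℂ) by push_cast; ring, ← Complex.ofReal_mul,
    Complex.ofReal_re]
  ring

theorem gaussianMeasure_univ_ne_zero : gaussianMeasure W Set.univ ≠ 0 := by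
  rw [gaussianMeasure_univ]
  intro h
  rw [lintegral_eq_zero_iff measurable_gaussianDensity] at h
  have hex : ∃ x : W, gaussianDensity x = 0 := by
    have := h.exists
    simpa using this
  obtain ⟨x, hx⟩ := hex
  simp only [gaussianDensity, ENNReal.ofReal_eq_zero] at hx
  exact absurd hx (not_le.mpr (Real.exp_pos _))

/-- On the half-space the density at `y` is at most `exp(-r²/2)` times the density at `y - r • a`,
and Lebesgue measure is translation invariant. Working with the unnormalized measure avoids
computing its total mass. -/
theorem gaussianMeasure_tail {a : W} (ha : ‖a‖ ≤ 1) {r : ℝ} (hr : 0 ≤ r) :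
    gaussianMeasure W {y | r < ⟪a, y⟫} ≤
      ENNReal.ofReal (Real.exp (-r ^ 2 / 2)) * gaussianMeasure W Set.univ := by
  have hS : MeasurableSet {y : W | r < ⟪a, y⟫} := measurableSet_lt (by fun_prop) (by fun_prop)
  rw [gaussianMeasure_apply hS, gaussianMeasure_univ,
    ← lintegral_sub_right_eq_self (μ := (volume : Measure W)) gaussianDensity (r • a),
    ← lintegral_const_mul (f := fun y : W => gaussianDensity (y - r • a)) _
      (measurable_gaussianDensity.comp (by fun_prop))]
  refine lintegral_mono fun y => ?_
  by_cases hy : y ∈ {y : W | r < ⟪a, y⟫}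
  · simp only [hy, Set.indicator_of_mem, Pi.one_apply, one_mul, gaussianDensity]
    rw [← ENNReal.ofReal_mul (Real.exp_pos _).le, ← Real.exp_add]
    refine ENNReal.ofReal_le_ofReal (Real.exp_le_exp.mpr ?_)
    have h1 : ‖y - r • a‖ ^ 2 = ‖y‖ ^ 2 - 2 * (r * ⟪a, y⟫) + r ^ 2 * ‖a‖ ^ 2 := by
      rw [norm_sub_sq_real, inner_smul_right, norm_smul, mul_pow, real_inner_comm]
      simp
    have h2 : r * r ≤ r * ⟪a, y⟫ := mul_le_mul_of_nonneg_left (le_of_lt hy) hr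
    have h3 : r ^ 2 * ‖a‖ ^ 2 ≤ r ^ 2 * 1 :=
      mul_le_mul_of_nonneg_left (pow_le_one₀ (norm_nonneg _) ha) (sq_nonneg r)
    rw [h1]
    linarith
  · simp [hy]

/-- By symmetry of `K`, the measure of the translate is the average of the integrals over `K` of the
densities at `y + z` and `-y + z`. This average is `exp(-‖z‖²/2) * cosh ⟪y, z⟫` times the density at
`y`, and `cosh ≥ 1`. -/
theorem gaussianMeasure_shift {K : Set W} (hK : MeasurableSet K) (hsymm : ∀ y, -y ∈ K ↔ y ∈ K)
    (z : W) :
    ENNReal.ofReal (Real.exp (-‖z‖ ^ 2 / 2)) * gaussianMeasure W K ≤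
      gaussianMeasure W ((fun y => y - z) ⁻¹' K) := by
  have hK' : MeasurableSet ((fun y => y - z) ⁻¹' K) := hK.preimage (by fun_prop)
  have hm : ∀ g : W → W, Measurable g →
      Measurable fun y => K.indicator (1 : W → ℝ≥0∞) y * gaussianDensity (g y) := fun g hg =>
    ((measurable_one.indicator hK).mul (measurable_gaussianDensity.comp hg))
  have e1 : gaussianMeasure W ((fun y => y - z) ⁻¹' K) =
      ∫⁻ y, K.indicator 1 y * gaussianDensity (y + z) := by
    rw [gaussianMeasure_apply hK', ← lintegral_add_right_eq_self (μ := (volume : Measure W)) _ z]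
    refine lintegral_congr fun y => ?_
    by_cases hy : y ∈ K <;> simp [Set.indicator, hy]
  have e2 : gaussianMeasure W ((fun y => y - z) ⁻¹' K) =
      ∫⁻ y, K.indicator 1 y * gaussianDensity (-y + z) := by
    rw [e1, ← lintegral_neg_eq_self (μ := (volume : Measure W))]
    refine lintegral_congr fun y => ?_
    by_cases hy : y ∈ K <;> simp [Set.indicator, hy, hsymm]
  have e3 : 2 * (ENNReal.ofReal (Real.exp (-‖z‖ ^ 2 / 2)) * gaussianMeasure W K) ≤
      2 * gaussianMeasure W ((fun y => y - z) ⁻¹' K) := by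
    conv_rhs => rw [two_mul]; enter [1]; rw [e1]
    conv_rhs => enter [2]; rw [e2]
    rw [← lintegral_add_left (hm _ (by fun_prop)), gaussianMeasure_apply hK,
      ← lintegral_const_mul _ (hm (fun y => y) (by fun_prop)),
      ← lintegral_const_mul _ ((hm (fun y => y) (by fun_prop)).const_mul _)]
    refine lintegral_mono fun y => ?_
    by_cases hy : y ∈ K
    · simp only [hy, Set.indicator_of_mem, Pi.one_apply, one_mul, gaussianDensity]
      rw [← ENNReal.ofReal_mul (Real.exp_pos _).le,
        ← ENNReal.ofReal_add (Real.exp_pos _).le (Real.exp_pos _).le,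
        show (2 : ℝ≥0∞) = ENNReal.ofReal 2 by simp, ← ENNReal.ofReal_mul (by norm_num)]
      refine ENNReal.ofReal_le_ofReal ?_
      have h1 : -‖y + z‖ ^ 2 / 2 = (-‖z‖ ^ 2 / 2 + -‖y‖ ^ 2 / 2) - ⟪y, z⟫ := by
        rw [norm_add_sq_real]; ring
      have h2 : -‖-y + z‖ ^ 2 / 2 = (-‖z‖ ^ 2 / 2 + -‖y‖ ^ 2 / 2) + ⟪y, z⟫ := by
        rw [norm_add_sq_real, inner_neg_left, norm_neg]; ring
      have h3 := Real.one_le_cosh ⟪y, z⟫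
      rw [Real.cosh_eq] at h3
      rw [h1, h2, ← Real.exp_add, sub_eq_add_neg, Real.exp_add _ (-⟪y, z⟫),
        Real.exp_add _ ⟪y, z⟫, ← mul_add, mul_comm]
      exact mul_le_mul_of_nonneg_left (by linarith) (Real.exp_pos _).le
    · simp [hy]
  exact (ENNReal.mul_le_mul_iff_right (by norm_num) (by norm_num)).mp e3

/-- A packing bound for the unit ball with respect to a polyhedral seminorm. -/
theorem card_le_of_separated {ι : Type*} [Fintype ι] {a : ι → W} (ha : ∀ i, ‖a i‖ ≤ 1)
    {r t : ℝ} (hr : 0 < r) (ht : 0 < t)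
    (hcard : 4 * (Fintype.card ι : ℝ) * Real.exp (-r ^ 2 / 2) ≤ 1)
    (S : Finset W) (hS : ∀ x ∈ S, ‖x‖ ≤ 1)
    (hsep : ∀ x ∈ S, ∀ y ∈ S, x ≠ y → ∃ i, t < |⟪a i, x - y⟫|) :
    (S.card : ℝ) ≤ 2 * Real.exp (2 * r ^ 2 / t ^ 2) := by
  -- The slab intersection `K` carries at least half of the Gaussian mass, by `hcard` and a union
  -- bound over the `2 * card ι` tails.
  set K : Set W := {y | ∀ i, |⟪a i, y⟫| ≤ r} with hKdef
  have hK : MeasurableSet K := by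
    have : K = ⋂ i, {y | |⟪a i, y⟫| ≤ r} := by ext; simp [hKdef]
    rw [this]
    exact MeasurableSet.iInter fun i => measurableSet_le
      (continuous_abs.measurable.comp (by fun_prop)) measurable_const
  have hsymm : ∀ y, -y ∈ K ↔ y ∈ K := fun y => by simp [hKdef]
  set M := gaussianMeasure W Set.univ with hM
  have hMtop : M ≠ ∞ := gaussianMeasure_univ_ne_top
  have hM0 : M ≠ 0 := gaussianMeasure_univ_ne_zero
  have : IsFiniteMeasure (gaussianMeasure W) := ⟨lt_top_iff_ne_top.mpr hMtop⟩
  have hMr : 0 < M.toReal := ENNReal.toReal_pos hM0 hMtop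
  have tail : ∀ b : W, ‖b‖ ≤ 1 →
      (gaussianMeasure W).real {y | r < ⟪b, y⟫} ≤ Real.exp (-r ^ 2 / 2) * M.toReal := by
    intro b hb
    have := ENNReal.toReal_mono (ENNReal.mul_ne_top ENNReal.ofReal_ne_top hMtop)
      (gaussianMeasure_tail hb hr.le)
    rwa [ENNReal.toReal_mul, ENNReal.toReal_ofReal (Real.exp_pos _).le] at this
  have hKc : (gaussianMeasure W).real Kᶜ ≤ M.toReal / 2 := by
    have hsub : Kᶜ ⊆ ⋃ i ∈ (Finset.univ : Finset ι),
        ({y | r < ⟪a i, y⟫} ∪ {y | r < ⟪-a i, y⟫}) := by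
      intro y hy
      simp only [hKdef, Set.mem_compl_iff, Set.mem_ofPred_eq, not_forall, not_le] at hy
      obtain ⟨i, hi⟩ := hy
      simp only [Finset.mem_univ, Set.iUnion_true, Set.mem_iUnion]
      refine ⟨i, ?_⟩
      rcases lt_abs.mp hi with h | h
      · exact Or.inl h
      · exact Or.inr (by simpa using h)
    calc (gaussianMeasure W).real Kᶜ
        ≤ (gaussianMeasure W).real (⋃ i ∈ (Finset.univ : Finset ι),
            ({y | r < ⟪a i, y⟫} ∪ {y | r < ⟪-a i, y⟫})) := measureReal_mono hsub (measure_ne_top _ _)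
      _ ≤ ∑ i, (gaussianMeasure W).real ({y | r < ⟪a i, y⟫} ∪ {y | r < ⟪-a i, y⟫}) :=
          measureReal_biUnion_finset_le _ _
      _ ≤ ∑ _i : ι, 2 * (Real.exp (-r ^ 2 / 2) * M.toReal) := by
          refine Finset.sum_le_sum fun i _ => (measureReal_union_le _ _).trans ?_
          rw [two_mul]
          exact add_le_add (tail _ (ha i)) (tail _ (by simpa using ha i))
      _ = 4 * (Fintype.card ι : ℝ) * Real.exp (-r ^ 2 / 2) * (M.toReal / 2) := by
          simp only [Finset.sum_const, Finset.card_univ, nsmul_eq_mul]; ring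
      _ ≤ M.toReal / 2 := by nlinarith
  have hKm : M.toReal / 2 ≤ (gaussianMeasure W).real K := by
    have := measureReal_add_measureReal_compl (μ := gaussianMeasure W) hK
    have h2 : (gaussianMeasure W).real Set.univ = M.toReal := rfl
    linarith
  -- Dilating by `2r/t` turns `t`-separation into separation by more than `2r`, so the translates of
  -- `K` at the points `s • x` are disjoint. Each has mass at least `exp(-s²/2) * M/2`, and `s²/2 =
  -- 2r²/t²`.
  set s : ℝ := 2 * r / t with hs
  have hs0 : 0 < s := by positivity
  have shift : ∀ x ∈ S, Real.exp (-s ^ 2 / 2) * (M.toReal / 2) ≤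
      (gaussianMeasure W).real ((fun y => y - s • x) ⁻¹' K) := by
    intro x hx
    have h1 := ENNReal.toReal_mono (measure_ne_top _ _) (gaussianMeasure_shift hK hsymm (s • x))
    rw [ENNReal.toReal_mul, ENNReal.toReal_ofReal (Real.exp_pos _).le] at h1
    refine le_trans (mul_le_mul ?_ hKm (by positivity) (Real.exp_pos _).le) h1
    refine Real.exp_le_exp.mpr ?_
    have h2 : ‖s • x‖ ^ 2 ≤ s ^ 2 := by
      rw [norm_smul, mul_pow, Real.norm_eq_abs, sq_abs]
      exact mul_le_of_le_one_right (sq_nonneg s) (pow_le_one₀ (norm_nonneg _) (hS x hx))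
    linarith
  have hdisj : (S : Set W).PairwiseDisjoint fun x => (fun y => y - s • x) ⁻¹' K := by
    intro x hx x' hx' hne
    rw [Function.onFun, Set.disjoint_left]
    intro y hy hy'
    obtain ⟨i, hi⟩ := hsep x hx x' hx' hne
    have h1 : |⟪a i, y - s • x⟫| ≤ r := hy i
    have h2 : |⟪a i, y - s • x'⟫| ≤ r := hy' i
    have h3 : s * ⟪a i, x - x'⟫ = ⟪a i, y - s • x'⟫ - ⟪a i, y - s • x⟫ := by
      simp only [inner_sub_right, inner_smul_right]; ring
    have h4 : s * |⟪a i, x - x'⟫| ≤ 2 * r := by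
      rw [← abs_of_pos hs0, ← abs_mul, h3]
      exact (abs_sub _ _).trans (by linarith)
    have h5 : s * t = 2 * r := by rw [hs]; field_simp
    nlinarith
  have hsum : ∑ x ∈ S, (gaussianMeasure W).real ((fun y => y - s • x) ⁻¹' K) ≤ M.toReal := by
    rw [← measureReal_biUnion_finset hdisj fun x _ => hK.preimage (by fun_prop)]
    exact measureReal_mono (Set.subset_univ _)
  have hfin : (S.card : ℝ) * (Real.exp (-s ^ 2 / 2) * (M.toReal / 2)) ≤ M.toReal := by
    refine le_trans ?_ hsum
    rw [← nsmul_eq_mul, ← Finset.sum_const]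
    exact Finset.sum_le_sum shift
  have hexp : Real.exp (2 * r ^ 2 / t ^ 2) * Real.exp (-s ^ 2 / 2) = 1 := by
    rw [← Real.exp_add, Real.exp_eq_one_iff, hs]
    field_simp
    ring
  have h6 : (S.card : ℝ) * Real.exp (-s ^ 2 / 2) ≤ 2 := by
    by_contra! h
    nlinarith
  calc (S.card : ℝ) = Real.exp (2 * r ^ 2 / t ^ 2) * ((S.card : ℝ) * Real.exp (-s ^ 2 / 2)) := by
        rw [mul_left_comm, hexp, mul_one]
    _ ≤ Real.exp (2 * r ^ 2 / t ^ 2) * 2 := mul_le_mul_of_nonneg_left h6 (Real.exp_pos _).le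
    _ = _ := mul_comm _ _

/-- A small net of the unit ball with respect to a polyhedral seminorm. -/
theorem exists_net {ι : Type*} [Fintype ι] {a : ι → W} (ha : ∀ i, ‖a i‖ ≤ 1)
    {r t : ℝ} (hr : 0 < r) (ht : 0 < t)
    (hcard : 4 * (Fintype.card ι : ℝ) * Real.exp (-r ^ 2 / 2) ≤ 1) :
    ∃ N : Finset W, (N.card : ℝ) ≤ 2 * Real.exp (2 * r ^ 2 / t ^ 2) ∧ (∀ y ∈ N, ‖y‖ ≤ 1) ∧
      ∀ x, ‖x‖ ≤ 1 → ∃ y ∈ N, ∀ i, |⟪a i, x - y⟫| ≤ t := by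
  classical
  -- The packing bound lets one take a separated set of maximal cardinality, which is then a net.
  let P : ℕ → Prop := fun k => ∃ S : Finset W, S.card = k ∧ (∀ x ∈ S, ‖x‖ ≤ 1) ∧
    ∀ x ∈ S, ∀ y ∈ S, x ≠ y → ∃ i, t < |⟪a i, x - y⟫|
  have hb : ∀ k, P k → k ≤ ⌊2 * Real.exp (2 * r ^ 2 / t ^ 2)⌋₊ := by
    rintro k ⟨S, rfl, h1, h2⟩
    exact Nat.le_floor (card_le_of_separated ha hr ht hcard S h1 h2)
  have h0 : P 0 := ⟨∅, by simp⟩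
  obtain ⟨S, hSc, hS1, hS2⟩ := Nat.findGreatest_spec (P := P) (Nat.zero_le _) h0
  refine ⟨S, card_le_of_separated ha hr ht hcard S hS1 hS2, hS1, fun x hx => ?_⟩
  by_contra! hno
  have hxS : x ∉ S := fun h => by
    obtain ⟨i, hi⟩ := hno x h
    simp only [sub_self, inner_zero_right, abs_zero] at hi
    linarith
  have hP : P (S.card + 1) := by
    refine ⟨insert x S, Finset.card_insert_of_notMem hxS, ?_, ?_⟩
    · simpa [hx] using hS1
    · intro u hu v hv huv
      rw [Finset.mem_insert] at hu hv
      rcases hu with rfl | hu <;> rcases hv with rfl | hv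
      · exact absurd rfl huv
      · exact hno v hv
      · obtain ⟨i, hi⟩ := hno u hu
        exact ⟨i, by rwa [← neg_sub, inner_neg_right, abs_neg]⟩
      · exact hS2 u hu v hv huv
  have := Nat.le_findGreatest (hb _ hP) hP
  rw [← hSc] at this
  omega

end GaussianCovering

/-! ### Bernstein-type tails for independent Bernoulli trials -/

section Bernstein

variable {E : Type*} [Fintype E]

/-- The law of independent Bernoulli trials with success probabilities `p e`. -/
noncomputable def bernoulliLaw (p : E → unitInterval) : Measure (E → Bool) :=
  Measure.pi fun e => bernoulliMeasure true false (p e)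

instance (p : E → unitInterval) : IsProbabilityMeasure (bernoulliLaw p) := by
  unfold bernoulliLaw
  infer_instance

/-- The indicator of success of a trial. -/
def outcome (b : Bool) : ℝ := if b then 1 else 0

theorem outcome_nonneg (b : Bool) : 0 ≤ outcome b := by
  unfold outcome; split_ifs <;> norm_num

theorem exp_le_one_add_add_sq {z : ℝ} (hz : |z| ≤ 1) : Real.exp z ≤ 1 + z + z ^ 2 := by
  have := Real.abs_exp_sub_one_sub_id_le hz
  have := (abs_le.mp this).2
  linarith

/-- The centred moment generating function is compared with the variance proxy `p z²`, through `exp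
z ≤ 1 + z + z²` for `|z| ≤ 1`. The factor `p` is what later makes the error relative to the mean. -/
theorem bernoulli_mgf_le {p z : ℝ} (hp : 0 ≤ p) (hz : |z| ≤ 1) :
    p * Real.exp (z * (1 - p)) + (1 - p) * Real.exp (z * (0 - p)) ≤ Real.exp (p * z ^ 2) := by
  have h1 : Real.exp (z * (1 - p)) = Real.exp (z * (0 - p)) * Real.exp z := by
    rw [← Real.exp_add]; congr 1; ring
  have h2 : 1 + p * (Real.exp z - 1) ≤ Real.exp (p * (z + z ^ 2)) := by
    have := Real.add_one_le_exp (p * (z + z ^ 2))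
    have h3 : p * (Real.exp z - 1) ≤ p * (z + z ^ 2) :=
      mul_le_mul_of_nonneg_left (by linarith [exp_le_one_add_add_sq hz]) hp
    linarith
  calc p * Real.exp (z * (1 - p)) + (1 - p) * Real.exp (z * (0 - p))
      = Real.exp (z * (0 - p)) * (1 + p * (Real.exp z - 1)) := by rw [h1]; ring
    _ ≤ Real.exp (z * (0 - p)) * Real.exp (p * (z + z ^ 2)) :=
        mul_le_mul_of_nonneg_left h2 (Real.exp_pos _).le
    _ = Real.exp (p * z ^ 2) := by rw [← Real.exp_add]; congr 1; ring

theorem integral_exp_bernoulliLaw_le (p : E → unitInterval) {z : E → ℝ} (hz : ∀ e, |z e| ≤ 1) :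
    ∫ s, Real.exp (∑ e, z e * (outcome (s e) - p e)) ∂(bernoulliLaw p) ≤
      Real.exp (∑ e, (p e : ℝ) * z e ^ 2) := by
  simp only [Real.exp_sum]
  rw [bernoulliLaw, integral_fintype_prod_eq_prod
    (f := fun e b => Real.exp (z e * (outcome b - p e)))]
  refine Finset.prod_le_prod (fun e _ => integral_nonneg fun b => (Real.exp_pos _).le)
    fun e _ => ?_
  rw [integral_bernoulliMeasure]
  simpa [outcome] using bernoulli_mgf_le (p e).2.1 (hz e)

theorem bernoulliLaw_upper_tail (p : E → unitInterval) {z : E → ℝ} (hz : ∀ e, |z e| ≤ 1)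
    (u : ℝ) :
    (bernoulliLaw p).real {s | ∑ e, (p e : ℝ) * z e ^ 2 + u < ∑ e, z e * (outcome (s e) - p e)} ≤
      Real.exp (-u) := by
  set A := ∑ e, (p e : ℝ) * z e ^ 2
  have h1 := mul_meas_ge_le_integral_of_nonneg (μ := bernoulliLaw p)
    (f := fun s => Real.exp (∑ e, z e * (outcome (s e) - p e)))
    (Filter.Eventually.of_forall fun s => (Real.exp_pos _).le) (Integrable.of_finite)
    (Real.exp (A + u))
  have h2 : (bernoulliLaw p).real {s | A + u < ∑ e, z e * (outcome (s e) - p e)} ≤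
      (bernoulliLaw p).real {s | Real.exp (A + u) ≤
        Real.exp (∑ e, z e * (outcome (s e) - p e))} :=
    measureReal_mono fun s hs => Real.exp_le_exp.mpr (le_of_lt hs)
  have h3 := h1.trans (integral_exp_bernoulliLaw_le p hz)
  have h4 : Real.exp (A + u) * (bernoulliLaw p).real
      {s | A + u < ∑ e, z e * (outcome (s e) - p e)} ≤ Real.exp (A + u) * Real.exp (-u) := by
    refine (mul_le_mul_of_nonneg_left h2 (Real.exp_pos _).le).trans (h3.trans (le_of_eq ?_))
    rw [← Real.exp_add]; congr 1; ring
  exact le_of_mul_le_mul_left h4 (Real.exp_pos _)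

/-- A Bernstein-type inequality with relative error `θ`. -/
theorem bernoulliLaw_tail (p : E → unitInterval) {c : E → ℝ} (hc0 : ∀ e, 0 ≤ c e)
    (hc1 : ∀ e, c e ≤ 1) {θ : ℝ} (hθ0 : 0 < θ) (hθ1 : θ ≤ 1) (u : ℝ) :
    (bernoulliLaw p).real {s | θ * ∑ e, p e * c e + u / θ <
      |∑ e, (outcome (s e) - p e) * c e|} ≤ 2 * Real.exp (-u) := by
  have hz : ∀ σ : ℝ, |σ| = 1 → ∀ e, |σ * θ * c e| ≤ 1 := fun σ hσ e => by
    rw [abs_mul, abs_mul, hσ, one_mul, abs_of_pos hθ0, abs_of_nonneg (hc0 e)]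
    exact mul_le_one₀ hθ1 (hc0 e) (hc1 e)
  -- The one-sided bound is used with `z = ±θ c`. Since `c² ≤ c`, the variance term is at most `θ²`
  -- times the mean; dividing by `θ` gives both terms of the threshold.
  have hsub : {s : E → Bool | θ * ∑ e, p e * c e + u / θ < |∑ e, (outcome (s e) - p e) * c e|} ⊆
      {s | ∑ e, (p e : ℝ) * (1 * θ * c e) ^ 2 + u < ∑ e, (1 * θ * c e) * (outcome (s e) - p e)} ∪
      {s | ∑ e, (p e : ℝ) * (-1 * θ * c e) ^ 2 + u <
        ∑ e, (-1 * θ * c e) * (outcome (s e) - p e)} := by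
    intro s hs
    simp only [Set.mem_ofPred_eq] at hs
    have h1 : ∀ σ : ℝ, |σ| = 1 →
        ∑ e, (p e : ℝ) * (σ * θ * c e) ^ 2 ≤ θ * (θ * ∑ e, p e * c e) := by
      intro σ hσ
      rw [Finset.mul_sum, Finset.mul_sum]
      refine Finset.sum_le_sum fun e _ => ?_
      have hσ2 : σ ^ 2 = 1 := by rw [← sq_abs, hσ, one_pow]
      have : (p e : ℝ) * (σ * θ * c e) ^ 2 = θ * (θ * (p e * (c e * c e))) := by
        rw [mul_pow, mul_pow, hσ2]; ring
      rw [this]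
      have hp := (p e).2.1
      gcongr
      exact mul_le_of_le_one_left (hc0 e) (hc1 e)
    have h2 : ∀ σ : ℝ, ∑ e, (σ * θ * c e) * (outcome (s e) - p e) =
        θ * (σ * ∑ e, (outcome (s e) - p e) * c e) := by
      intro σ
      rw [Finset.mul_sum, Finset.mul_sum]
      exact Finset.sum_congr rfl fun e _ => by ring
    have h3 : θ * (θ * ∑ e, p e * c e) + u < θ * |∑ e, (outcome (s e) - p e) * c e| := by
      have := mul_lt_mul_of_pos_left hs hθ0
      rwa [mul_add, mul_div_cancel₀ _ hθ0.ne'] at this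
    rcases abs_choice (∑ e, (outcome (s e) - p e) * c e) with h | h
    · left
      simp only [Set.mem_ofPred_eq, h2]
      have := h1 1 (by simp)
      rw [h] at h3
      linarith
    · right
      simp only [Set.mem_ofPred_eq, h2]
      have := h1 (-1) (by simp)
      rw [h] at h3
      linarith
  calc _ ≤ _ := measureReal_mono hsub
    _ ≤ _ := measureReal_union_le _ _
    _ ≤ Real.exp (-u) + Real.exp (-u) := add_le_add
        (bernoulliLaw_upper_tail p (hz 1 (by simp)) u)
        (bernoulliLaw_upper_tail p (hz (-1) (by simp)) u)
    _ = _ := by ring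

/-- Trials of success probability `1` succeed almost surely. -/
theorem bernoulliLaw_sure (p : E → unitInterval) :
    (bernoulliLaw p).real {s | ∃ e, p e = 1 ∧ s e = false} = 0 := by
  have hsub : {s : E → Bool | ∃ e, p e = 1 ∧ s e = false} ⊆
      ⋃ e ∈ (Finset.univ : Finset E), {s | p e = 1 ∧ s e = false} := by
    rintro s ⟨e, he⟩
    simp only [Finset.mem_univ, Set.iUnion_true, Set.mem_iUnion]
    exact ⟨e, he⟩
  refine le_antisymm ((measureReal_mono hsub (measure_ne_top _ _)).trans
    ((measureReal_biUnion_finset_le _ _).trans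
    (Finset.sum_nonpos fun e _ => ?_))) measureReal_nonneg
  by_cases he : p e = 1
  · have hset : {s : E → Bool | p e = 1 ∧ s e = false} =
        Function.eval e ⁻¹' ({false} : Set Bool) := by
      ext s; simp [he]
    rw [hset, measureReal_def, bernoulliLaw,
      (measurePreserving_eval (fun e => bernoulliMeasure true false (p e)) e).measure_preimage
        (measurableSet_singleton _).nullMeasurableSet, he]
    simp
  · simp [he]

end Bernstein

/-! ### Dyadic slices of a squared quantity -/

section Clamp

/-- The part of `q` lying between `t` and `2 * t`. -/
def dyadicPart (t q : ℝ) : ℝ := min q (2 * t) - min q t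

theorem dyadicPart_nonneg {t q : ℝ} (ht : 0 ≤ t) : 0 ≤ dyadicPart t q :=
  sub_nonneg.mpr (min_le_min_left _ (by linarith))

theorem dyadicPart_le {t q : ℝ} (ht : 0 ≤ t) : dyadicPart t q ≤ t := by
  unfold dyadicPart
  rcases le_total q t with h | h
  · rw [min_eq_left h, min_eq_left (by linarith)]; linarith
  · rw [min_eq_right h]; linarith [min_le_right q (2 * t)]

theorem sum_dyadicPart (t : ℝ) (q : ℝ) (J : ℕ) :
    ∑ j ∈ Finset.range J, dyadicPart (t * 2 ^ j) q = min q (t * 2 ^ J) - min q t := by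
  have : ∀ j, dyadicPart (t * 2 ^ j) q = min q (t * 2 ^ (j + 1)) - min q (t * 2 ^ j) := fun j => by
    rw [dyadicPart, pow_succ]; ring_nf
  simp only [this]
  rw [Finset.sum_range_sub (fun j => min q (t * 2 ^ j))]
  simp

/-- A perturbation of size `η√t` can change the slice at `t` only if `a²` is already close to `t`.
Then the slice at `t/2` is a constant fraction of `t`, so the change is paid for by the level below,
with no additive error. -/
theorem abs_dyadicPart_sq_sub_le {a b t η : ℝ} (ha : 0 ≤ a) (hb : 0 ≤ b) (ht : 0 ≤ t)
    (hη : η ≤ 1 / 8) (hab : |a - b| ≤ η * √t) :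
    |dyadicPart t (a ^ 2) - dyadicPart t (b ^ 2)| ≤ 12 * η * dyadicPart (t / 2) (a ^ 2) := by
  obtain ⟨τ, hτ0, rfl⟩ : ∃ τ : ℝ, 0 ≤ τ ∧ t = τ ^ 2 :=
    ⟨√t, Real.sqrt_nonneg _, (Real.sq_sqrt ht).symm⟩
  rw [Real.sqrt_sq hτ0] at hab
  obtain ⟨h1, h2⟩ := abs_le.mp hab
  rcases hτ0.eq_or_lt with rfl | hτ
  · have : a = b := by simp only [mul_zero] at h1 h2; linarith
    subst this
    simp [dyadicPart]
  have hη0 : 0 ≤ η := by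
    have := (abs_nonneg _).trans hab
    exact nonneg_of_mul_nonneg_left this hτ
  -- If `a² ≤ 3t/4`, then `a ≤ (7/8)√t` and `b ≤ √t`, so both slices vanish. Otherwise the slice at
  -- `t/2` is at least `t/4` and the slice at `t` moves by at most `3ηt`, whence the constant `12`.
  rcases le_total (a ^ 2) (3 / 4 * τ ^ 2) with h | h
  · have ha' : a ≤ 7 / 8 * τ := by
      refine le_of_sq_le_sq ?_ (by positivity)
      nlinarith
    have hb' : b ≤ τ := by nlinarith
    have hb2 : b ^ 2 ≤ τ ^ 2 := by gcongr
    have hz1 : dyadicPart (τ ^ 2) (a ^ 2) = 0 := by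
      rw [dyadicPart, min_eq_left (by nlinarith), min_eq_left (by nlinarith), sub_self]
    have hz2 : dyadicPart (τ ^ 2) (b ^ 2) = 0 := by
      rw [dyadicPart, min_eq_left (by nlinarith), min_eq_left (by nlinarith), sub_self]
    rw [hz1, hz2, sub_self, abs_zero]
    have := dyadicPart_nonneg (t := τ ^ 2 / 2) (q := a ^ 2) (by positivity)
    positivity
  · have hlow : τ ^ 2 / 4 ≤ dyadicPart (τ ^ 2 / 2) (a ^ 2) := by
      rw [dyadicPart, mul_div_cancel₀ _ (two_ne_zero)]
      rw [min_eq_right (a := a ^ 2) (b := τ ^ 2 / 2) (by nlinarith)]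
      have : 3 / 4 * τ ^ 2 ≤ min (a ^ 2) (τ ^ 2) := le_min h (by nlinarith)
      linarith
    have hmain : |dyadicPart (τ ^ 2) (a ^ 2) - dyadicPart (τ ^ 2) (b ^ 2)| ≤ 3 * η * τ ^ 2 := by
      have lip : ∀ x y : ℝ, 0 ≤ x → 0 ≤ y → |x - y| ≤ η * τ →
          dyadicPart (τ ^ 2) (x ^ 2) ≤ dyadicPart (τ ^ 2) (y ^ 2) + 3 * η * τ ^ 2 := by
        intro x y hx hy hxy
        have hxy' := (abs_le.mp hxy).2
        have hd : min (x ^ 2) (2 * τ ^ 2) ≤ min (y ^ 2) (2 * τ ^ 2) + 3 * η * τ ^ 2 := by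
          rcases le_total (2 * τ ^ 2) (y ^ 2) with hy2 | hy2
          · rw [min_eq_right hy2]
            exact (min_le_right _ _).trans (le_add_of_nonneg_right (by positivity))
          · rw [min_eq_left hy2]
            refine (min_le_left _ _).trans ?_
            -- `23/16` exceeds `√2` and satisfies `2 * (23/16) + 1/8 = 3`, which is the constant in
            -- `3 * η * τ ^ 2`.
            have hy3 : y ≤ 23 / 16 * τ := by
              refine le_of_sq_le_sq ?_ (by positivity)
              nlinarith [sq_nonneg τ]
            have hx2 : x ≤ y + η * τ := by linarith
            have : x ^ 2 ≤ (y + η * τ) ^ 2 := by gcongr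
            nlinarith [mul_nonneg hη0 hτ.le, mul_nonneg (mul_nonneg hη0 hτ.le) hτ.le,
              mul_nonneg (mul_nonneg hη0 hτ.le) (sub_nonneg.mpr hy3)]
        have hc : ∀ q : ℝ, dyadicPart (τ ^ 2) q = max (min q (2 * τ ^ 2)) (τ ^ 2) - τ ^ 2 := by
          intro q
          rw [dyadicPart]
          rcases le_total q (τ ^ 2) with hq | hq
          · rw [min_eq_left hq, min_eq_left (by nlinarith), max_eq_right hq]; ring
          · rw [min_eq_right hq, max_eq_left (le_min hq (by nlinarith))]
        rw [hc, hc]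
        have : max (min (x ^ 2) (2 * τ ^ 2)) (τ ^ 2) ≤
            max (min (y ^ 2) (2 * τ ^ 2)) (τ ^ 2) + 3 * η * τ ^ 2 := by
          refine max_le (hd.trans (by gcongr; exact le_max_left _ _)) ?_
          exact (le_max_right _ _).trans (le_add_of_nonneg_right (by positivity))
        linarith
      have l1 := lip a b ha hb hab
      have l2 := lip b a hb ha (by rwa [abs_sub_comm])
      exact abs_le.mpr ⟨by linarith, by linarith⟩
    nlinarith

end Clamp

/-! ### Gradients, resistance vectors and Foster's inequality -/

namespace WeightedGraph

open scoped RealInnerProductSpace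

variable {V F : Type*}

/-- A choice of a first endpoint for every edge. -/
noncomputable def src (G : WeightedGraph V F) (f : F) : V := (Quot.out (G.ends f)).1

/-- The second endpoint of every edge. -/
noncomputable def tgt (G : WeightedGraph V F) (f : F) : V := (Quot.out (G.ends f)).2

theorem ends_eq (G : WeightedGraph V F) (f : F) : G.ends f = s(G.src f, G.tgt f) :=
  (Quot.out_eq (G.ends f)).symm

theorem src_ne_tgt (G : WeightedGraph V F) (f : F) : G.src f ≠ G.tgt f := by
  have := G.loopless f
  rw [ends_eq] at this
  simpa using this

/-- The weighted gradient `f ↦ √w(f) · (x_u - x_v)`, where `f = {u, v}`. -/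
noncomputable def gradient (G : WeightedGraph V F) (x : V → ℝ) : EuclideanSpace ℝ F :=
  WithLp.toLp 2 fun f => √(G.weight f) * (x (G.src f) - x (G.tgt f))

theorem laplacian_transpose [DecidableEq V] [Fintype F] (G : WeightedGraph V F) :
    G.laplacianᵀ = G.laplacian := by
  simpa [Matrix.IsHermitian, Matrix.conjTranspose_eq_transpose_of_trivial] using
    G.laplacian_isHermitian

theorem Connected.eq_of_gradient_eq_zero {G : WeightedGraph V F} (hG : G.Connected) {x : V → ℝ}
    (hx : G.gradient x = 0) (u v : V) : x u = x v := by
  obtain ⟨p⟩ := hG.preconnected u v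
  induction p with
  | nil => rfl
  | cons hadj _ ih =>
    refine Eq.trans ?_ ih
    rw [support, SimpleGraph.fromEdgeSet_adj] at hadj
    obtain ⟨⟨f, hf, hw⟩, -⟩ := hadj
    have h1 : G.gradient x f = 0 := by rw [hx]; rfl
    have h2 : x (G.src f) = x (G.tgt f) := by
      simpa [gradient, (Real.sqrt_pos.mpr hw).ne', sub_eq_zero] using h1
    rw [ends_eq, Sym2.eq_iff] at hf
    rcases hf with ⟨rfl, rfl⟩ | ⟨rfl, rfl⟩
    · exact h2
    · exact h2.symm

theorem laplacian_apply_eq_sum [DecidableEq V] [Fintype F] (G : WeightedGraph V F) (u v : V) :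
    G.laplacian u v = ∑ f, G.weight f *
      (chiDiff (G.src f) (G.tgt f) u * chiDiff (G.src f) (G.tgt f) v) := by
  have hB : ∀ f, chiDiff (G.src f) (G.tgt f) u * chiDiff (G.src f) (G.tgt f) v =
      if u = v then (if u ∈ G.ends f then (1 : ℝ) else 0)
        else - (if G.ends f = s(u, v) then 1 else 0) := by
    intro f
    have hne := G.src_ne_tgt f
    rw [ends_eq]
    simp only [chiDiff, Pi.sub_apply, Pi.single_apply, Sym2.mem_iff, Sym2.eq_iff]
    grind
  by_cases h : u = v
  · subst h
    simp only [hB]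
    simp [laplacian, Finset.sum_filter]
  · simp [hB, laplacian, h, Finset.sum_filter]

variable [Fintype V] [DecidableEq V]

theorem dotProduct_chiDiff (x : V → ℝ) (u v : V) : x ⬝ᵥ chiDiff u v = x u - x v := by
  simp [chiDiff, dotProduct_sub]

variable [Fintype F] (G : WeightedGraph V F)

theorem inner_gradient (x y : V → ℝ) :
    ⟪G.gradient x, G.gradient y⟫ = x ⬝ᵥ (G.laplacian *ᵥ y) := by
  have h1 : ∀ x : V → ℝ, ∀ f, ∑ u, x u * chiDiff (G.src f) (G.tgt f) u =
      x (G.src f) - x (G.tgt f) := fun x f => dotProduct_chiDiff x _ _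
  have h2 : ⟪G.gradient x, G.gradient y⟫ =
      ∑ f, G.weight f * ((x (G.src f) - x (G.tgt f)) * (y (G.src f) - y (G.tgt f))) := by
    simp only [gradient, PiLp.inner_apply, RCLike.inner_apply, conj_trivial]
    refine Finset.sum_congr rfl fun f _ => ?_
    have := Real.mul_self_sqrt (G.weight_nonneg f)
    linear_combination ((x (G.src f) - x (G.tgt f)) * (y (G.src f) - y (G.tgt f))) * this
  rw [h2]
  simp only [dotProduct, mulVec, laplacian_apply_eq_sum, Finset.mul_sum, Finset.sum_mul]
  rw [Finset.sum_congr rfl fun u _ => Finset.sum_comm, Finset.sum_comm]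
  refine Finset.sum_congr rfl fun f _ => ?_
  rw [← h1 x f, ← h1 y f, Finset.sum_mul_sum, Finset.mul_sum]
  refine Finset.sum_congr rfl fun u _ => ?_
  rw [Finset.mul_sum]
  exact Finset.sum_congr rfl fun v _ => by ring

theorem pinv_laplacian_transpose : (pinv G.laplacian)ᵀ = pinv G.laplacian := by
  have hB := G.isMoorePenroseInverse_pinv_laplacian
  have hL := G.laplacian_transpose
  have hr : G.laplacian * (pinv G.laplacian)ᵀ = pinv G.laplacian * G.laplacian := by
    have := hB.transpose_right
    rwa [Matrix.transpose_mul, hL] at this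
  have hl : (pinv G.laplacian)ᵀ * G.laplacian = G.laplacian * pinv G.laplacian := by
    have := hB.transpose_left
    rwa [Matrix.transpose_mul, hL] at this
  refine IsMoorePenroseInverse.unique (A := G.laplacian) ⟨?_, ?_, ?_, ?_⟩ hB
  · simpa [hL, Matrix.mul_assoc] using congrArg Matrix.transpose hB.mul_mul_left
  · simpa [hL, Matrix.mul_assoc] using congrArg Matrix.transpose hB.mul_mul_right
  · rw [hr, hB.transpose_right]
  · rw [hl, hB.transpose_left]

/-- The vector representing the functional `x ↦ x_u - x_v` through the gradient. -/
noncomputable def resVec (u v : V) : EuclideanSpace ℝ F :=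
  G.gradient (pinv G.laplacian *ᵥ chiDiff u v)

theorem norm_resVec_sq (u v : V) : ‖G.resVec u v‖ ^ 2 = G.effRes u v := by
  rw [← real_inner_self_eq_norm_sq, resVec, inner_gradient, effRes]
  conv_rhs => rw [← G.isMoorePenroseInverse_pinv_laplacian.mul_mul_right, ← Matrix.mulVec_mulVec,
    ← Matrix.mulVec_mulVec, Matrix.dotProduct_mulVec, ← Matrix.mulVec_transpose,
    G.pinv_laplacian_transpose]

variable {G}

/-- The defect `z = χ - L L⁺ χ` lies in the kernel of `L`, so it is constant by connectedness and
hence orthogonal to `χ`. It is also orthogonal to the range of the symmetric projection `L L⁺`, so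
`z ⬝ᵥ z = 0`. -/
theorem Connected.laplacian_mul_pinv_mulVec (hG : G.Connected) (u v : V) :
    G.laplacian *ᵥ (pinv G.laplacian *ᵥ chiDiff u v) = chiDiff u v := by
  have hB := G.isMoorePenroseInverse_pinv_laplacian
  set P := G.laplacian * pinv G.laplacian with hP
  have hPP : P * P = P := by rw [hP, ← Matrix.mul_assoc, hB.mul_mul_left]
  have hLP : G.laplacian * P = G.laplacian := by
    have := congrArg Matrix.transpose hB.mul_mul_left
    rwa [← hP, Matrix.transpose_mul, hB.transpose_left, G.laplacian_transpose] at this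
  set z := chiDiff u v - P *ᵥ chiDiff u v with hz
  have hLz : G.laplacian *ᵥ z = 0 := by
    rw [hz, Matrix.mulVec_sub, Matrix.mulVec_mulVec, hLP, sub_self]
  have hPz : P *ᵥ z = 0 := by
    rw [hz, Matrix.mulVec_sub, Matrix.mulVec_mulVec, hPP, sub_self]
  have hgrad : G.gradient z = 0 := by
    rw [← inner_self_eq_zero (𝕜 := ℝ), inner_gradient, hLz, dotProduct_zero]
  have hzz : z ⬝ᵥ z = 0 := by
    conv_lhs => rw [hz, ← hz, dotProduct_sub]
    rw [dotProduct_chiDiff, hG.eq_of_gradient_eq_zero hgrad u v, sub_self, zero_sub,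
      Matrix.dotProduct_mulVec, ← Matrix.mulVec_transpose, hB.transpose_left, hPz,
      zero_dotProduct, neg_zero]
  have hz0 : z = 0 := dotProduct_self_eq_zero.mp hzz
  rw [Matrix.mulVec_mulVec]
  exact (sub_eq_zero.mp hz0).symm

theorem Connected.inner_resVec (hG : G.Connected) (u v : V) (x : V → ℝ) :
    ⟪G.resVec u v, G.gradient x⟫ = x u - x v := by
  rw [real_inner_comm, resVec, inner_gradient, hG.laplacian_mul_pinv_mulVec, dotProduct_chiDiff]

variable (G)

/-- Foster's theorem (as an inequality). -/
theorem sum_weight_mul_effRes_le :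
    ∑ f, G.weight f * G.effResPair (G.ends f) ≤ Fintype.card V := by
  have hB := G.isMoorePenroseInverse_pinv_laplacian
  set P := pinv G.laplacian * G.laplacian with hP
  have hPP : P * P = P := by rw [hP, ← Matrix.mul_assoc, hB.mul_mul_right]
  have hPt : Pᵀ = P := hB.transpose_right
  -- The sum is the trace of `L⁺ L`, a symmetric idempotent, whose diagonal entries satisfy `P u u =
  -- ∑ v, P u v ^ 2 ≥ P u u ^ 2` and so are at most `1`.
  have htr : ∑ f, G.weight f * G.effResPair (G.ends f) = ∑ u, P u u := by
    have h1 : ∀ f, G.effResPair (G.ends f) = ∑ u, ∑ v, pinv G.laplacian u v *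
        (chiDiff (G.src f) (G.tgt f) v * chiDiff (G.src f) (G.tgt f) u) := by
      intro f
      rw [ends_eq]
      simp only [effResPair, Sym2.lift_mk, effRes, dotProduct, mulVec, Finset.mul_sum]
      exact Finset.sum_congr rfl fun u _ => Finset.sum_congr rfl fun v _ => by ring
    simp only [hP, Matrix.mul_apply, laplacian_apply_eq_sum, h1, Finset.mul_sum]
    rw [Finset.sum_comm]
    refine Finset.sum_congr rfl fun u _ => ?_
    rw [Finset.sum_comm]
    exact Finset.sum_congr rfl fun v _ => Finset.sum_congr rfl fun f _ => by ring
  have hdiag : ∀ u, P u u ≤ 1 := by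
    intro u
    have h1 : P u u = ∑ v, P u v ^ 2 := by
      conv_lhs => rw [← hPP, Matrix.mul_apply]
      refine Finset.sum_congr rfl fun v _ => ?_
      have : P v u = P u v := by conv_lhs => rw [← hPt, Matrix.transpose_apply]
      rw [this, sq]
    have h2 : P u u ^ 2 ≤ ∑ v, P u v ^ 2 :=
      Finset.single_le_sum (f := fun v => P u v ^ 2) (fun v _ => sq_nonneg _) (Finset.mem_univ u)
    rw [← h1] at h2
    nlinarith
  rw [htr]
  calc ∑ u, P u u ≤ ∑ _u : V, (1 : ℝ) := Finset.sum_le_sum fun u _ => hdiag u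
    _ = Fintype.card V := by simp

end WeightedGraph

/-! ### Uniform concentration by levels -/

section Sampling

open scoped RealInnerProductSpace

variable {W : Type*} [NormedAddCommGroup W] [InnerProductSpace ℝ W] [FiniteDimensional ℝ W]
  {E ι : Type*} [Fintype E] [Fintype ι]

/-- Concentration of the contribution of a single dyadic level. -/
theorem exists_bad_level (p : E → unitInterval) {a : ι → W} (ha : ∀ i, ‖a i‖ ≤ 1)
    {h : E → W → ℝ} (h0 : ∀ e z, 0 ≤ h e z)
    (hLip : ∀ e x y b, 0 ≤ b → (∀ i, |⟪a i, x - y⟫| ≤ b) → |h e x - h e y| ≤ b)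
    {n : ℕ} (hn : 2 ≤ n) (hι : Fintype.card ι ≤ n ^ 2)
    {η : ℝ} (hη0 : 0 < η) (hη1 : η ≤ 1 / 8) {t : ℝ} (ht0 : 0 < t) (ht1 : t ≤ 1) :
    ∃ B : Set (E → Bool), (bernoulliLaw p).real B ≤ 4 / (n : ℝ) ^ 2 ∧
      ∀ s ∉ B, ∀ z, ‖z‖ ≤ 1 →
        |∑ e, (outcome (s e) - p e) * dyadicPart t (h e z ^ 2)| ≤
          12 * η * ∑ e, (outcome (s e) + 2 * p e) * dyadicPart (t / 2) (h e z ^ 2) +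
          η * ∑ e, p e * dyadicPart t (h e z ^ 2) + 18 * Real.log n / η ^ 3 := by
  borelize W
  set L := Real.log n with hL
  have hn0 : (0 : ℝ) < n := by positivity
  have hn2 : (2 : ℝ) ≤ n := by exact_mod_cast hn
  have hL0 : 0 < L := Real.log_pos (by linarith)
  have hexpL : Real.exp L = n := Real.exp_log hn0
  have hexp2 : Real.exp (-(2 * L)) = 1 / (n : ℝ) ^ 2 := by
    rw [Real.exp_neg, two_mul, Real.exp_add, hexpL]; field_simp
  -- With `r² = 8 log n`, the Gaussian tail is `n⁻⁴`, which beats the at most `n²` functionals with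
  -- room for the factor `4`.
  have hr2 : √(8 * L) ^ 2 = 8 * L := Real.sq_sqrt (by positivity)
  have hcard : 4 * (Fintype.card ι : ℝ) * Real.exp (-√(8 * L) ^ 2 / 2) ≤ 1 := by
    have h1 : Real.exp (-√(8 * L) ^ 2 / 2) = 1 / (n : ℝ) ^ 2 * (1 / (n : ℝ) ^ 2) := by
      rw [hr2, ← hexp2, ← Real.exp_add]; congr 1; ring
    have h2 : (Fintype.card ι : ℝ) ≤ (n : ℝ) ^ 2 := by exact_mod_cast hι
    calc 4 * (Fintype.card ι : ℝ) * Real.exp (-√(8 * L) ^ 2 / 2)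
        ≤ 4 * (n : ℝ) ^ 2 * (1 / (n : ℝ) ^ 2 * (1 / (n : ℝ) ^ 2)) := by rw [h1]; gcongr
      _ = 4 / (n : ℝ) ^ 2 := by field_simp
      _ ≤ 1 := by rw [div_le_one (by positivity)]; nlinarith
  have hst : 0 < √t := Real.sqrt_pos.mpr ht0
  obtain ⟨N, hNc, -, hN⟩ := exists_net ha (Real.sqrt_pos.mpr (by positivity : 0 < 8 * L))
    (mul_pos hη0 hst) hcard
  -- The net has size at most `2 exp(16L/(η²t))`. The value `18` leaves `exp(-2L/(η²t)) ≤ n⁻²` after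
  -- the union bound, and `t * u / η = 18L/η³` no longer depends on `t`.
  set u : ℝ := 18 * L / (η ^ 2 * t) with hu
  let c : W → E → ℝ := fun y e => dyadicPart t (h e y ^ 2) / t
  refine ⟨⋃ y ∈ N, {s | η * ∑ e, p e * c y e + u / η <
    |∑ e, (outcome (s e) - p e) * c y e|}, ?_, ?_⟩
  · calc (bernoulliLaw p).real _ ≤ ∑ y ∈ N, (bernoulliLaw p).real {s |
          η * ∑ e, p e * c y e + u / η < |∑ e, (outcome (s e) - p e) * c y e|} :=
        measureReal_biUnion_finset_le _ _
      _ ≤ ∑ _y ∈ N, 2 * Real.exp (-u) := Finset.sum_le_sum fun y _ =>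
        bernoulliLaw_tail p (fun e => div_nonneg (dyadicPart_nonneg ht0.le) ht0.le)
          (fun e => (div_le_one ht0).mpr (dyadicPart_le ht0.le)) hη0 (by linarith) u
      _ = N.card * (2 * Real.exp (-u)) := by rw [Finset.sum_const, nsmul_eq_mul]
      _ ≤ (2 * Real.exp (2 * √(8 * L) ^ 2 / (η * √t) ^ 2)) * (2 * Real.exp (-u)) := by gcongr
      _ = 4 * Real.exp (-(2 * L / (η ^ 2 * t))) := by
        rw [hr2, mul_pow, Real.sq_sqrt ht0.le, hu,
          show -(2 * L / (η ^ 2 * t)) = 2 * (8 * L) / (η ^ 2 * t) + -(18 * L / (η ^ 2 * t)) by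
            ring, Real.exp_add]
        ring
      _ ≤ 4 * Real.exp (-(2 * L)) := by
        gcongr
        rw [le_div_iff₀ (by positivity)]
        have : η ^ 2 * t ≤ 1 := mul_le_one₀ (pow_le_one₀ hη0.le (by linarith)) ht0.le ht1
        exact mul_le_of_le_one_right (by positivity) this
      _ = 4 / (n : ℝ) ^ 2 := by rw [hexp2]; ring
  · intro s hs z hz
    obtain ⟨y, hy, hyz⟩ := hN z hz
    have hs' : |∑ e, (outcome (s e) - p e) * c y e| ≤ η * ∑ e, p e * c y e + u / η := by
      by_contra! hcon
      exact hs (Set.mem_biUnion hy hcon)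
    have hclose : ∀ e, |dyadicPart t (h e z ^ 2) - dyadicPart t (h e y ^ 2)| ≤
        12 * η * dyadicPart (t / 2) (h e z ^ 2) := fun e =>
      abs_dyadicPart_sq_sub_le (h0 e z) (h0 e y) ht0.le hη1 (hLip e z y _ (by positivity) hyz)
    have hs2 : |∑ e, (outcome (s e) - p e) * dyadicPart t (h e y ^ 2)| ≤
        η * ∑ e, p e * dyadicPart t (h e y ^ 2) + 18 * L / η ^ 3 := by
      have e1 : ∑ e, (outcome (s e) - p e) * dyadicPart t (h e y ^ 2) =
          t * ∑ e, (outcome (s e) - p e) * c y e := by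
        rw [Finset.mul_sum]
        refine Finset.sum_congr rfl fun e _ => ?_
        simp only [c]; field_simp
      have e2 : ∑ e, p e * dyadicPart t (h e y ^ 2) = t * ∑ e, p e * c y e := by
        rw [Finset.mul_sum]
        refine Finset.sum_congr rfl fun e _ => ?_
        simp only [c]; field_simp
      rw [e1, e2, abs_mul, abs_of_pos ht0]
      refine (mul_le_mul_of_nonneg_left hs' ht0.le).trans (le_of_eq ?_)
      rw [hu]; field_simp
    have hdiff : |∑ e, (outcome (s e) - p e) * dyadicPart t (h e z ^ 2) -
        ∑ e, (outcome (s e) - p e) * dyadicPart t (h e y ^ 2)| ≤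
        12 * η * ∑ e, (outcome (s e) + p e) * dyadicPart (t / 2) (h e z ^ 2) := by
      rw [← Finset.sum_sub_distrib, Finset.mul_sum]
      refine (Finset.abs_sum_le_sum_abs _ _).trans (Finset.sum_le_sum fun e _ => ?_)
      rw [← mul_sub, abs_mul]
      have h1 : |outcome (s e) - p e| ≤ outcome (s e) + p e := by
        have := outcome_nonneg (s e)
        have := (p e).2.1
        exact abs_le.mpr ⟨by linarith, by linarith⟩
      calc _ ≤ (outcome (s e) + p e) * (12 * η * dyadicPart (t / 2) (h e z ^ 2)) :=
            mul_le_mul h1 (hclose e) (abs_nonneg _) ((abs_nonneg _).trans h1)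
        _ = _ := by ring
    have hpy : ∑ e, p e * dyadicPart t (h e y ^ 2) ≤ ∑ e, p e * dyadicPart t (h e z ^ 2) +
        12 * η * ∑ e, p e * dyadicPart (t / 2) (h e z ^ 2) := by
      rw [Finset.mul_sum, ← Finset.sum_add_distrib]
      refine Finset.sum_le_sum fun e _ => ?_
      have h1 := (abs_le.mp (hclose e)).1
      have h2 : dyadicPart t (h e y ^ 2) ≤ dyadicPart t (h e z ^ 2) +
        12 * η * dyadicPart (t / 2) (h e z ^ 2) := by linarith
      calc _ ≤ _ := mul_le_mul_of_nonneg_left h2 (p e).2.1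
        _ = _ := by ring
    have hPn : 0 ≤ ∑ e, p e * dyadicPart (t / 2) (h e z ^ 2) := Finset.sum_nonneg fun e _ =>
      mul_nonneg (p e).2.1 (dyadicPart_nonneg (by positivity))
    have hsplit : ∑ e, (outcome (s e) + 2 * p e) * dyadicPart (t / 2) (h e z ^ 2) =
        ∑ e, (outcome (s e) + p e) * dyadicPart (t / 2) (h e z ^ 2) +
        ∑ e, p e * dyadicPart (t / 2) (h e z ^ 2) := by
      -- Of the coefficient `2 * p e`, one part bounds `|outcome - p|` and the other pays for moving
      -- the mean from the net point `y` back to `z`.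
      rw [← Finset.sum_add_distrib]
      exact Finset.sum_congr rfl fun e _ => by ring
    have htri := abs_sub_abs_le_abs_sub
      (∑ e, (outcome (s e) - p e) * dyadicPart t (h e z ^ 2))
      (∑ e, (outcome (s e) - p e) * dyadicPart t (h e y ^ 2))
    have h5 := mul_le_mul_of_nonneg_left hpy hη0.le
    have h6 : η * (12 * η * ∑ e, p e * dyadicPart (t / 2) (h e z ^ 2)) ≤
        1 * (12 * η * ∑ e, p e * dyadicPart (t / 2) (h e z ^ 2)) := by
      gcongr
      linarith
    rw [hsplit]
    linarith

/-- The number of successful trials is unlikely to exceed twice its mean by much. -/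
theorem bernoulliLaw_count_tail (p : E → unitInterval) (u : ℝ) :
    (bernoulliLaw p).real {s | 2 * ∑ e, (p e : ℝ) + u < ∑ e, outcome (s e)} ≤
      2 * Real.exp (-u) := by
  refine (measureReal_mono fun s hs => ?_).trans (bernoulliLaw_tail p (c := fun _ => 1)
    (fun _ => zero_le_one) (fun _ => le_rfl) one_pos le_rfl u)
  simp only [Set.mem_ofPred_eq, mul_one, one_mul, div_one, Finset.sum_sub_distrib] at hs ⊢
  refine lt_of_lt_of_le ?_ (le_abs_self _)
  linarith

/-- The number of dyadic levels is logarithmic in `n`. -/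
theorem exists_levels {n : ℕ} (hn : 2 ≤ n) :
    ∃ J : ℕ, (128 : ℝ) * n ^ 3 ≤ 2 ^ J ∧ (J : ℝ) ≤ 20 * Real.log n := by
  have hn2 : (2 : ℝ) ≤ n := by exact_mod_cast hn
  -- Three logarithms give `n³`, and `2 ^ 7 = 128`.
  refine ⟨3 * Nat.clog 2 n + 7, ?_, ?_⟩
  · have h1 : (n : ℝ) ≤ 2 ^ Nat.clog 2 n := by exact_mod_cast Nat.le_pow_clog one_lt_two n
    calc (128 : ℝ) * n ^ 3 ≤ 128 * (2 ^ Nat.clog 2 n) ^ 3 := by gcongr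
      _ = _ := by rw [← pow_mul, pow_add, mul_comm (Nat.clog 2 n)]; norm_num; ring
  · have hk : 1 ≤ Nat.clog 2 n := Nat.clog_pos one_lt_two hn
    have h1 : 2 ^ (Nat.clog 2 n - 1) < n := Nat.pow_pred_clog_lt_self one_lt_two hn
    have h2 : ((2 : ℝ) ^ (Nat.clog 2 n - 1)) ≤ n := by exact_mod_cast h1.le
    have h3 := Real.log_le_log (by positivity) h2
    rw [Real.log_pow, Nat.cast_sub hk, Nat.cast_one] at h3
    have h4 : Real.log 2 ≤ Real.log n := Real.log_le_log (by norm_num) hn2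
    have h5 := Real.log_two_gt_d9
    push_cast
    nlinarith [Real.log_nonneg (show (1 : ℝ) ≤ n by linarith)]

set_option maxHeartbeats 1000000 in
/-- Uniform concentration of the energies under independent sampling. -/
theorem sampling_concentration (p : E → unitInterval) {a : ι → W} (ha : ∀ i, ‖a i‖ ≤ 1)
    {h : E → W → ℝ} (h0 : ∀ e z, 0 ≤ h e z) (h1 : ∀ e z, ‖z‖ ≤ 1 → h e z ≤ 1)
    (hLip : ∀ e x y b, 0 ≤ b → (∀ i, |⟪a i, x - y⟫| ≤ b) → |h e x - h e y| ≤ b)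
    {n : ℕ} (hn : 2 ≤ n) (hι : Fintype.card ι ≤ n ^ 2) {ε lam γ : ℝ} (hε0 : 1 / (n : ℝ) ≤ ε)
    (hε1 : ε < 1) (hγ1 : 1 ≤ γ) (hγn : γ ≤ n) (hp : ∑ e, (p e : ℝ) ≤ lam * (4 * γ * n))
    (hlam : 10 ^ 10 * Real.log n ^ 3 / ε ^ 4 ≤ lam) :
    ∃ B : Set (E → Bool), (bernoulliLaw p).real B ≤ 100 * Real.log n / n ∧
      ∀ s ∉ B, ∀ z, ‖z‖ ≤ 1 → ∑ e, p e * h e z ^ 2 ≤ lam →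
        |∑ e, (outcome (s e) - p e) * h e z ^ 2| ≤ ε * lam := by
  set L := Real.log n with hL
  have hn2 : (2 : ℝ) ≤ n := by exact_mod_cast hn
  have hn0 : (0 : ℝ) < n := by linarith
  have hL69 : 0.69 ≤ L := by
    have := Real.log_le_log (by norm_num) hn2
    have := Real.log_two_gt_d9
    linarith
  have hε : 0 < ε := lt_of_lt_of_le (by positivity) hε0
  obtain ⟨J, hJ1, hJ2⟩ := exists_levels hn
  set σ : ℝ := (2 ^ J)⁻¹ with hσ
  have hσ0 : 0 < σ := by positivity
  have hσJ : σ * 2 ^ J = 1 := inv_mul_cancel₀ (by positivity)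
  have hσle : ∀ j ∈ Finset.range J, σ * 2 ^ j ≤ 1 := fun j hj => by
    rw [← hσJ]
    have := (Finset.mem_range.mp hj).le
    gcongr
    -- The remaining goal is that the base `2` is at least `1`.
    norm_num
  set η : ℝ := ε / 100 with hη
  have hη0 : 0 < η := by positivity
  have hlev : ∀ j ∈ Finset.range J, ∃ B : Set (E → Bool),
      (bernoulliLaw p).real B ≤ 4 / (n : ℝ) ^ 2 ∧ ∀ s ∉ B, ∀ z, ‖z‖ ≤ 1 →
        |∑ e, (outcome (s e) - p e) * dyadicPart (σ * 2 ^ j) (h e z ^ 2)| ≤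
          12 * η * ∑ e, (outcome (s e) + 2 * p e) * dyadicPart (σ * 2 ^ j / 2) (h e z ^ 2) +
          η * ∑ e, p e * dyadicPart (σ * 2 ^ j) (h e z ^ 2) + 18 * L / η ^ 3 := fun j hj =>
    exists_bad_level p ha h0 hLip hn hι hη0 (by linarith) (by positivity) (hσle j hj)
  choose! Bj hBj1 hBj2 using hlev
  refine ⟨(⋃ j ∈ Finset.range J, Bj j) ∪
    {s | 2 * ∑ e, (p e : ℝ) + 2 * L < ∑ e, outcome (s e)}, ?_, ?_⟩
  · have hexp2 : Real.exp (-(2 * L)) = 1 / (n : ℝ) ^ 2 := by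
      rw [Real.exp_neg, two_mul, Real.exp_add, Real.exp_log hn0]; field_simp
    calc (bernoulliLaw p).real _ ≤ ∑ j ∈ Finset.range J, (bernoulliLaw p).real (Bj j) +
          2 * Real.exp (-(2 * L)) := (measureReal_union_le _ _).trans
            (add_le_add (measureReal_biUnion_finset_le _ _) (bernoulliLaw_count_tail p _))
      _ ≤ ∑ _j ∈ Finset.range J, 4 / (n : ℝ) ^ 2 + 2 * Real.exp (-(2 * L)) := by
          gcongr with j hj
          exact hBj1 j hj
      _ = (4 * J + 2) / (n : ℝ) ^ 2 := by
          rw [Finset.sum_const, Finset.card_range, nsmul_eq_mul, hexp2]; ring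
      _ ≤ (100 * L) / (n : ℝ) ^ 2 := by gcongr; linarith
      _ ≤ 100 * L / n := by
          gcongr
          nlinarith
  · intro s hs z hz hB
    simp only [Set.mem_union, Set.mem_iUnion, not_or, not_exists, Set.mem_ofPred_eq, not_lt] at hs
    obtain ⟨hsj, hcount⟩ := hs
    set q : E → ℝ := fun e => h e z ^ 2 with hq
    have hq0 : ∀ e, 0 ≤ q e := fun e => sq_nonneg _
    have hq1 : ∀ e, q e ≤ 1 := fun e => pow_le_one₀ (h0 e z) (h1 e z hz)
    have hwn : ∀ e, 0 ≤ outcome (s e) + 2 * p e := fun e => by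
      have := outcome_nonneg (s e)
      have := (p e).2.1
      positivity
    set D := ∑ e, (outcome (s e) - p e) * q e with hD
    have htel : ∀ e, q e = min (q e) σ + ∑ j ∈ Finset.range J, dyadicPart (σ * 2 ^ j) (q e) := by
      intro e
      rw [sum_dyadicPart, hσJ, min_eq_left (hq1 e)]; ring
    have hDsplit : D = ∑ e, (outcome (s e) - p e) * min (q e) σ +
        ∑ j ∈ Finset.range J, ∑ e, (outcome (s e) - p e) * dyadicPart (σ * 2 ^ j) (q e) := by
      rw [Finset.sum_comm, ← Finset.sum_add_distrib, hD]
      refine Finset.sum_congr rfl fun e _ => ?_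
      rw [← Finset.mul_sum, ← mul_add, ← htel e]
    have hbottom : |∑ e, (outcome (s e) - p e) * min (q e) σ| ≤
        σ * (∑ e, outcome (s e) + ∑ e, (p e : ℝ)) := by
      rw [← Finset.sum_add_distrib, Finset.mul_sum]
      refine (Finset.abs_sum_le_sum_abs _ _).trans (Finset.sum_le_sum fun e _ => ?_)
      have h3 := outcome_nonneg (s e)
      have h4 := (p e).2.1
      have h5 : |outcome (s e) - p e| ≤ outcome (s e) + p e :=
        abs_le.mpr ⟨by linarith, by linarith⟩
      rw [abs_mul, abs_of_nonneg (le_min (hq0 e) hσ0.le), mul_comm]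
      exact mul_le_mul (min_le_right _ _) h5 (abs_nonneg _) hσ0.le
    -- The half-shifted slices telescope as well, so the charges of all levels together cost the
    -- mass only once, without a factor `J`.
    have hlow : ∑ j ∈ Finset.range J, ∑ e,
        (outcome (s e) + 2 * p e) * dyadicPart (σ * 2 ^ j / 2) (q e) ≤
        ∑ e, (outcome (s e) + 2 * p e) * q e := by
      rw [Finset.sum_comm]
      refine Finset.sum_le_sum fun e _ => ?_
      rw [← Finset.mul_sum]
      refine mul_le_mul_of_nonneg_left ?_ (hwn e)
      have h3 := sum_dyadicPart (σ / 2) (q e) J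
      have h4 : ∀ j, σ / 2 * 2 ^ j = σ * 2 ^ j / 2 := fun j => by ring
      simp only [h4] at h3
      rw [h3]
      have := min_le_left (q e) (σ * 2 ^ J / 2)
      have : 0 ≤ min (q e) (σ / 2) := le_min (hq0 e) (by positivity)
      linarith
    have hmid : ∑ j ∈ Finset.range J, ∑ e, p e * dyadicPart (σ * 2 ^ j) (q e) ≤
        ∑ e, p e * q e := by
      rw [Finset.sum_comm]
      refine Finset.sum_le_sum fun e _ => ?_
      rw [← Finset.mul_sum]
      refine mul_le_mul_of_nonneg_left ?_ (p e).2.1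
      have := htel e
      have : 0 ≤ min (q e) σ := le_min (hq0 e) hσ0.le
      linarith
    have hlevels : |∑ j ∈ Finset.range J, ∑ e,
        (outcome (s e) - p e) * dyadicPart (σ * 2 ^ j) (q e)| ≤
        12 * η * ∑ e, (outcome (s e) + 2 * p e) * q e + η * ∑ e, p e * q e +
          J * (18 * L / η ^ 3) := by
      refine (Finset.abs_sum_le_sum_abs _ _).trans ((Finset.sum_le_sum fun j hj =>
        hBj2 j hj s (hsj j hj) z hz).trans ?_)
      rw [Finset.sum_add_distrib, Finset.sum_add_distrib, Finset.sum_const, Finset.card_range,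
        nsmul_eq_mul, ← Finset.mul_sum, ← Finset.mul_sum]
      gcongr
    -- The sampled mass is rewritten through `D` itself, making the estimate self-bounding.
    have hmass : ∑ e, (outcome (s e) + 2 * p e) * q e = D + 3 * ∑ e, p e * q e := by
      rw [hD, Finset.mul_sum, ← Finset.sum_add_distrib]
      exact Finset.sum_congr rfl fun e _ => by ring
    have hL3 : 0.69 * L ^ 2 ≤ L ^ 3 := by
      rw [pow_succ L 2, mul_comm]
      gcongr
    have hlam' : 6.9 * 10 ^ 9 * L ^ 2 / ε ^ 4 ≤ lam := by
      refine le_trans ?_ hlam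
      gcongr ?_ / _
      linarith
    have hlev2 : J * (18 * L / η ^ 3) ≤ ε * lam / 8 := by
      calc J * (18 * L / η ^ 3) ≤ 20 * L * (18 * L / η ^ 3) := by gcongr
        _ = ε * (3.6 * 10 ^ 8 * L ^ 2 / ε ^ 4) := by rw [hη]; field_simp; ring
        _ ≤ ε * (6.9 * 10 ^ 9 * L ^ 2 / ε ^ 4 / 8) := by
            refine mul_le_mul_of_nonneg_left ?_ hε.le
            rw [div_div, mul_comm (ε ^ 4), ← div_div]
            gcongr
            nlinarith
        _ ≤ ε * (lam / 8) := by gcongr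
        _ = _ := by ring
    have hlamL : L ≤ lam := by
      refine le_trans ?_ hlam'
      rw [le_div_iff₀ (by positivity)]
      have : ε ^ 4 ≤ 1 := pow_le_one₀ hε.le hε1.le
      calc L * ε ^ 4 ≤ L * 1 := by gcongr
        _ ≤ _ := by nlinarith
    -- `σ ≤ 1/(128 n³)`: two powers of `n` absorb `γ n ≤ n²`, and the third is traded for `ε`
    -- through `ε n ≥ 1`.
    have hσε : σ * (128 * (γ * n)) ≤ ε := by
      have h3 : 1 ≤ ε * n := by rwa [div_le_iff₀ hn0] at hε0
      have h4 : γ * n ≤ n * n := by gcongr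
      calc σ * (128 * (γ * n)) ≤ σ * (128 * (n * n)) := by gcongr
        _ ≤ σ * (128 * (n * n) * (ε * n)) := by
            refine mul_le_mul_of_nonneg_left ?_ hσ0.le
            exact le_mul_of_one_le_right (by positivity) h3
        _ = σ * (128 * n ^ 3) * ε := by ring
        _ ≤ σ * 2 ^ J * ε := by gcongr
        _ = ε := by rw [hσJ, one_mul]
    have hσL : σ * L ≤ ε * lam / 128 := by
      have h3 : 1 ≤ γ * n := one_le_mul_of_one_le_of_one_le hγ1 (by linarith)
      have h4 : σ * 128 ≤ ε := by
        refine le_trans ?_ hσε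
        gcongr
        linarith
      have : σ * 128 * L ≤ ε * lam := by gcongr
      linarith
    have hσp : σ * ∑ e, (p e : ℝ) ≤ ε * lam / 32 := by
      have hlam0 : 0 ≤ lam := by linarith
      calc σ * ∑ e, (p e : ℝ) ≤ σ * (lam * (4 * γ * n)) := by gcongr
        _ = σ * (128 * (γ * n)) * lam / 32 := by ring
        _ ≤ _ := by gcongr
    have hbot2 : σ * (∑ e, outcome (s e) + ∑ e, (p e : ℝ)) ≤ 3 * (ε * lam / 32) +
        2 * (ε * lam / 128) := by
      have : σ * (∑ e, outcome (s e) + ∑ e, (p e : ℝ)) ≤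
          3 * (σ * ∑ e, (p e : ℝ)) + 2 * (σ * L) := by
        calc _ ≤ σ * (2 * ∑ e, (p e : ℝ) + 2 * L + ∑ e, (p e : ℝ)) := by gcongr
          _ = _ := by ring
      linarith
    have hDle : |D| ≤ σ * (∑ e, outcome (s e) + ∑ e, (p e : ℝ)) +
        (12 * η * ∑ e, (outcome (s e) + 2 * p e) * q e + η * ∑ e, p e * q e +
          J * (18 * L / η ^ 3)) := by
      rw [hDsplit]
      exact (abs_add_le _ _).trans (add_le_add hbottom hlevels)
    rw [hmass] at hDle
    -- As `η = ε/100` and `ε < 1`, the coefficient of `|D|` is `12/100`. Adding the bottom part, the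
    -- means and the additive terms leaves `|D|` below `ελ`.
    have hDD : 12 * η * (D + 3 * ∑ e, p e * q e) ≤ 12 / 100 * |D| + 36 / 100 * (ε * lam) := by
      have h3 : η * D ≤ 1 / 100 * |D| := by
        calc η * D ≤ η * |D| := by gcongr; exact le_abs_self D
          _ ≤ 1 / 100 * |D| := by gcongr; linarith
      have h4 : η * ∑ e, p e * q e ≤ η * lam := by gcongr
      have h5 : η * lam = ε * lam / 100 := by rw [hη]; ring
      linarith
    have hBB : η * ∑ e, p e * q e ≤ ε * lam / 100 := by
      calc η * ∑ e, p e * q e ≤ η * lam := by gcongr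
        _ = _ := by rw [hη]; ring
    have : 0 ≤ ε * lam := mul_nonneg hε.le (by linarith)
    linarith

end Sampling

/-! ### Normalized resistance vectors -/

namespace WeightedGraph

open scoped RealInnerProductSpace

variable {V F : Type*} [Fintype V] [DecidableEq V] [Fintype F] (G : WeightedGraph V F)

/-- The vectors `resVec`, normalized by the square root of the effective resistance. -/
noncomputable def unitResVec (i : V × V) : EuclideanSpace ℝ F :=
  (√(G.effRes i.1 i.2))⁻¹ • G.resVec i.1 i.2

theorem norm_resVec (u v : V) : ‖G.resVec u v‖ = √(G.effRes u v) := by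
  rw [← norm_resVec_sq, Real.sqrt_sq (norm_nonneg _)]

theorem norm_unitResVec_le (i : V × V) : ‖G.unitResVec i‖ ≤ 1 := by
  rw [unitResVec, norm_smul, norm_resVec, norm_inv, Real.norm_of_nonneg (Real.sqrt_nonneg _)]
  exact inv_mul_le_one

theorem sqrt_effRes_smul_unitResVec (i : V × V) :
    √(G.effRes i.1 i.2) • G.unitResVec i = G.resVec i.1 i.2 := by
  rw [unitResVec, smul_smul]
  by_cases h : √(G.effRes i.1 i.2) = 0
  · have : G.resVec i.1 i.2 = 0 := by rw [← norm_eq_zero, norm_resVec, h]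
    rw [this, smul_zero]
  · rw [mul_inv_cancel₀ h, one_smul]

end WeightedGraph

/-- With the threshold `w(e)/n²`, this keeps the total weight of the light clique edges at most
`3/4` of `w(e)`. -/
theorem card_cliqueEdges_le {V : Type*} [Fintype V] [DecidableEq V] (hV : 2 ≤ Fintype.card V)
    (s : Finset V) : ((cliqueEdges s).card : ℝ) ≤ 3 / 4 * (Fintype.card V : ℝ) ^ 2 := by
  have h1 : (cliqueEdges s).card ≤ (Fintype.card V + 1).choose 2 := by
    refine (Finset.card_filter_le _ _).trans ?_
    rw [Finset.card_sym2]
    exact Nat.choose_le_choose 2 (Nat.add_le_add_right (Finset.card_le_univ s) 1)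
  have h2 : ((cliqueEdges s).card : ℝ) ≤ ((Fintype.card V + 1).choose 2 : ℕ) := by
    exact_mod_cast h1
  rw [Nat.cast_choose_two] at h2
  have h3 : (2 : ℝ) ≤ Fintype.card V := by exact_mod_cast hV
  push_cast at h2
  nlinarith

/-! ### Hyperedge energies and the reduction to concentration -/

namespace WeightedHypergraph

variable {V E : Type*}

/-- The energy `max_{u, v ∈ e} (x_u - x_v)²` of a single hyperedge. -/
noncomputable def edgeEnergy (H : WeightedHypergraph V E) (x : V → ℝ) (e : E) : ℝ :=
  (H.edge e ×ˢ H.edge e).sup' (H.edge_product_nonempty e) fun p => (x p.1 - x p.2) ^ 2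

theorem sq_sub_le_edgeEnergy (H : WeightedHypergraph V E) (x : V → ℝ) {e : E} {u v : V}
    (hu : u ∈ H.edge e) (hv : v ∈ H.edge e) : (x u - x v) ^ 2 ≤ H.edgeEnergy x e :=
  Finset.le_sup' (fun p : V × V => (x p.1 - x p.2) ^ 2)
    (Finset.mk_mem_product hu hv)

theorem edgeEnergy_nonneg (H : WeightedHypergraph V E) (x : V → ℝ) (e : E) :
    0 ≤ H.edgeEnergy x e := by
  obtain ⟨p, hp⟩ := H.edge_product_nonempty e
  obtain ⟨hu, hv⟩ := Finset.mem_product.mp hp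
  exact (sq_nonneg _).trans (H.sq_sub_le_edgeEnergy x hu hv)

theorem edgeEnergy_smul (H : WeightedHypergraph V E) (c : ℝ) (x : V → ℝ) (e : E) :
    H.edgeEnergy (c • x) e = c ^ 2 * H.edgeEnergy x e := by
  rw [edgeEnergy, edgeEnergy, Finset.mul₀_sup' (sq_nonneg c)]
  congr 1
  ext p
  simp only [Pi.smul_apply, smul_eq_mul]
  ring

theorem energy_eq [Fintype E] (H : WeightedHypergraph V E) (x : V → ℝ) :
    H.energy x = ∑ e, H.weight e * H.edgeEnergy x e := rfl

theorem energy_smul [Fintype E] (H : WeightedHypergraph V E) (c : ℝ) (x : V → ℝ) :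
    H.energy (c • x) = c ^ 2 * H.energy x := by
  simp only [energy_eq, edgeEnergy_smul, Finset.mul_sum]
  exact Finset.sum_congr rfl fun e _ => by ring

theorem energy_nonneg [Fintype E] (H : WeightedHypergraph V E) (x : V → ℝ) : 0 ≤ H.energy x :=
  Finset.sum_nonneg fun e _ => mul_nonneg (H.weight_nonneg e) (H.edgeEnergy_nonneg x e)

namespace WeightAssignment

open scoped RealInnerProductSpace

variable [Fintype V] [DecidableEq V] [Fintype E] {H : WeightedHypergraph V E}
  (G : H.WeightAssignment)

/-- Heavy clique edges have resistance at least `R^max(e)/γ` by balancedness. Light ones carry at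
most `3/4` of the weight, and moving their share to the left costs the factor `4`. -/
theorem weight_mul_maxRes_le (hV : 2 ≤ Fintype.card V) {γ : ℝ} (hγ : 0 ≤ γ)
    (hG : G.IsApproxBalanced (1 / (Fintype.card V : ℝ) ^ 2) γ) (e : E) :
    H.weight e * G.maxRes e ≤ 4 * γ * ∑ f : {f : Sym2 V // f ∈ cliqueEdges (H.edge e)},
      G.weight ⟨e, f⟩ * G.graph.effResPair f := by
  set n : ℝ := (Fintype.card V : ℝ)
  have hn : 0 < n := Nat.cast_pos.mpr (by omega)
  have hterm : ∀ f : {f : Sym2 V // f ∈ cliqueEdges (H.edge e)},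
      G.weight ⟨e, f⟩ * G.maxRes e ≤ γ * (G.weight ⟨e, f⟩ * G.graph.effResPair f) +
        1 / n ^ 2 * H.weight e * G.maxRes e := by
    intro f
    have h0 : 0 ≤ G.weight ⟨e, f⟩ := G.weight_nonneg _
    have h1 := H.weight_nonneg e
    have h2 := G.maxRes_nonneg e
    have h3 := G.graph.effResPair_nonneg f
    rcases le_total (1 / n ^ 2 * H.weight e) (G.weight ⟨e, f⟩) with h | h
    · have h4 : G.maxRes e ≤ γ * G.graph.effResPair f := Finset.sup'_le _ _ (hG e f h)
      have h5 := mul_le_mul_of_nonneg_left h4 h0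
      have : 0 ≤ 1 / n ^ 2 * H.weight e * G.maxRes e := by positivity
      linarith
    · have := mul_le_mul_of_nonneg_right h h2
      have : 0 ≤ γ * (G.weight ⟨e, f⟩ * G.graph.effResPair f) := by positivity
      linarith
  have hsum := Finset.sum_le_sum fun f (_ : f ∈ Finset.univ) => hterm f
  rw [← Finset.sum_mul, G.sum_weight, Finset.sum_add_distrib, ← Finset.mul_sum, Finset.sum_const,
    nsmul_eq_mul, Finset.card_univ, Fintype.card_coe] at hsum
  have hc := card_cliqueEdges_le hV (H.edge e)
  have h6 : ((cliqueEdges (H.edge e)).card : ℝ) * (1 / n ^ 2 * H.weight e * G.maxRes e) ≤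
      3 / 4 * (H.weight e * G.maxRes e) := by
    have h1 := H.weight_nonneg e
    have h2 := G.maxRes_nonneg e
    calc _ ≤ 3 / 4 * n ^ 2 * (1 / n ^ 2 * H.weight e * G.maxRes e) := by gcongr
      _ = _ := by field_simp
  linarith

theorem sum_weight_mul_maxRes_le (hV : 2 ≤ Fintype.card V) {γ : ℝ} (hγ : 0 ≤ γ)
    (hG : G.IsApproxBalanced (1 / (Fintype.card V : ℝ) ^ 2) γ) :
    ∑ e, H.weight e * G.maxRes e ≤ 4 * γ * Fintype.card V := by
  refine (Finset.sum_le_sum fun e _ => G.weight_mul_maxRes_le hV hγ hG e).trans ?_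
  rw [← Finset.mul_sum]
  refine mul_le_mul_of_nonneg_left ?_ (by positivity)
  have := G.graph.sum_weight_mul_effRes_le
  rwa [Fintype.sum_sigma] at this

/-- The weight of a hyperedge is split among its clique edges, none of which has larger squared
difference than the maximum over the hyperedge. -/
theorem norm_gradient_sq_le_energy (x : V → ℝ) : ‖G.graph.gradient x‖ ^ 2 ≤ H.energy x := by
  rw [← real_inner_self_eq_norm_sq, WeightedGraph.inner_gradient,
    WeightedGraph.dotProduct_laplacian_mulVec, Fintype.sum_sigma, energy_eq]
  refine Finset.sum_le_sum fun e _ => ?_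
  rw [← G.sum_weight e, Finset.sum_mul]
  refine Finset.sum_le_sum fun f _ => ?_
  refine mul_le_mul_of_nonneg_left ?_ (G.weight_nonneg _)
  obtain ⟨f, hf⟩ := f
  induction f with
  | _ u v =>
    have hf' := (Finset.mem_filter.mp hf).1
    rw [Finset.mk_mem_sym2_iff] at hf'
    exact H.sq_sub_le_edgeEnergy x hf'.1 hf'.2

theorem effRes_le_maxRes {e : E} {u v : V} (hu : u ∈ H.edge e) (hv : v ∈ H.edge e) :
    G.graph.effRes u v ≤ G.maxRes e := by
  by_cases huv : u = v
  · subst huv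
    have : WeightedGraph.chiDiff u u = 0 := sub_self _
    rw [WeightedGraph.effRes, this, zero_dotProduct]
    exact G.maxRes_nonneg e
  · exact Finset.le_sup' G.graph.effResPair
      (show s(u, v) ∈ cliqueEdges (H.edge e) by simp [cliqueEdges, hu, hv, huv])

/-- The extension of `x ↦ max_{u, v ∈ e} |x_u - x_v|` from gradients to all vectors. -/
noncomputable def edgeNorm (e : E) (z : EuclideanSpace ℝ H.CliqueEdge) : ℝ :=
  (H.edge e ×ˢ H.edge e).sup' (H.edge_product_nonempty e) fun p =>
    |⟪G.graph.resVec p.1 p.2, z⟫|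

theorem edgeNorm_nonneg (e : E) (z : EuclideanSpace ℝ H.CliqueEdge) : 0 ≤ G.edgeNorm e z := by
  obtain ⟨p, hp⟩ := H.edge_product_nonempty e
  exact (abs_nonneg _).trans (Finset.le_sup' (fun p : V × V => |⟪G.graph.resVec p.1 p.2, z⟫|) hp)

theorem edgeNorm_le (e : E) (z : EuclideanSpace ℝ H.CliqueEdge) :
    G.edgeNorm e z ≤ √(G.maxRes e) * ‖z‖ := by
  refine Finset.sup'_le _ _ fun p hp => (abs_real_inner_le_norm _ _).trans ?_
  obtain ⟨hu, hv⟩ := Finset.mem_product.mp hp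
  rw [WeightedGraph.norm_resVec]
  gcongr
  exact G.effRes_le_maxRes hu hv

theorem edgeNorm_le_add (e : E) (x y : EuclideanSpace ℝ H.CliqueEdge) {b : ℝ}
    (hb : ∀ i, |⟪G.graph.unitResVec i, x - y⟫| ≤ b) :
    G.edgeNorm e x ≤ G.edgeNorm e y + √(G.maxRes e) * b := by
  refine Finset.sup'_le _ _ fun p hp => ?_
  obtain ⟨hu, hv⟩ := Finset.mem_product.mp hp
  have h1 := Finset.le_sup' (fun p : V × V => |⟪G.graph.resVec p.1 p.2, y⟫|) hp
  have h2 : |⟪G.graph.resVec p.1 p.2, x - y⟫| ≤ √(G.maxRes e) * b := by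
    rw [← WeightedGraph.sqrt_effRes_smul_unitResVec, real_inner_smul_left, abs_mul,
      abs_of_nonneg (Real.sqrt_nonneg _)]
    exact mul_le_mul (Real.sqrt_le_sqrt (G.effRes_le_maxRes hu hv)) (hb p) (abs_nonneg _)
      (Real.sqrt_nonneg _)
  rw [inner_sub_right] at h2
  have h3 := abs_sub_abs_le_abs_sub ⟪G.graph.resVec p.1 p.2, x⟫ ⟪G.graph.resVec p.1 p.2, y⟫
  have h4 : |⟪G.graph.resVec p.1 p.2, y⟫| ≤ G.edgeNorm e y := h1
  linarith

variable {G}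

theorem edgeNorm_gradient_sq (hG : G.graph.Connected) (e : E) (x : V → ℝ) :
    G.edgeNorm e (G.graph.gradient x) ^ 2 = H.edgeEnergy x e := by
  have h0 := G.edgeNorm_nonneg e (G.graph.gradient x)
  refine le_antisymm ?_ (Finset.sup'_le _ _ fun p hp => ?_)
  · refine (Real.le_sqrt h0 (H.edgeEnergy_nonneg x e)).mp (Finset.sup'_le _ _ fun p hp => ?_)
    obtain ⟨hu, hv⟩ := Finset.mem_product.mp hp
    rw [hG.inner_resVec]
    refine Real.le_sqrt_of_sq_le ?_
    rw [sq_abs]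
    exact H.sq_sub_le_edgeEnergy x hu hv
  · have h1 := Finset.le_sup'
      (fun p : V × V => |⟪G.graph.resVec p.1 p.2, G.graph.gradient x⟫|) hp
    simp only [hG.inner_resVec] at h1
    have h2 : |x p.1 - x p.2| ≤ G.edgeNorm e (G.graph.gradient x) := by
      simpa only [edgeNorm, hG.inner_resVec] using h1
    rw [← sq_abs]
    gcongr

variable (G)

open Classical in
/-- The normalized size of `z` on the hyperedge `e`, set to zero on the hyperedges whose weight is
not affected by the sampling. -/
noncomputable def relNorm (lam : ℝ≥0) (e : E) (z : EuclideanSpace ℝ H.CliqueEdge) : ℝ :=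
  if G.sampleProb lam e = 1 ∨ H.weight e = 0 then 0 else G.edgeNorm e z / √(G.maxRes e)

theorem relNorm_nonneg (lam : ℝ≥0) (e : E) (z : EuclideanSpace ℝ H.CliqueEdge) :
    0 ≤ G.relNorm lam e z := by
  unfold relNorm
  split_ifs
  · exact le_rfl
  · exact div_nonneg (G.edgeNorm_nonneg e z) (Real.sqrt_nonneg _)

theorem relNorm_le_one (lam : ℝ≥0) (e : E) (z : EuclideanSpace ℝ H.CliqueEdge) (hz : ‖z‖ ≤ 1) :
    G.relNorm lam e z ≤ 1 := by
  unfold relNorm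
  split_ifs
  · exact zero_le_one
  · refine div_le_one_of_le₀ ((G.edgeNorm_le e z).trans ?_) (Real.sqrt_nonneg _)
    exact mul_le_of_le_one_right (Real.sqrt_nonneg _) hz

theorem abs_relNorm_sub_le (lam : ℝ≥0) (e : E) (x y : EuclideanSpace ℝ H.CliqueEdge) (b : ℝ)
    (hb0 : 0 ≤ b) (hb : ∀ i, |⟪G.graph.unitResVec i, x - y⟫| ≤ b) :
    |G.relNorm lam e x - G.relNorm lam e y| ≤ b := by
  unfold relNorm
  split_ifs
  · simpa using hb0
  · rw [← sub_div, abs_div, abs_of_nonneg (Real.sqrt_nonneg _)]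
    refine div_le_of_le_mul₀ (Real.sqrt_nonneg _) hb0 (abs_le.mpr ?_)
    have h1 := G.edgeNorm_le_add e x y hb
    have h2 := G.edgeNorm_le_add e y x (b := b) fun i => by
      rw [← neg_sub, inner_neg_right, abs_neg]; exact hb i
    constructor <;> linarith

variable {G}

theorem maxRes_mul_relNorm_sq_le (hG : G.graph.Connected) (lam : ℝ≥0) (e : E) (x : V → ℝ) :
    G.maxRes e * G.relNorm lam e (G.graph.gradient x) ^ 2 ≤ H.edgeEnergy x e := by
  unfold relNorm
  split_ifs
  · simpa using H.edgeEnergy_nonneg x e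
  · rw [div_pow, edgeNorm_gradient_sq hG, Real.sq_sqrt (G.maxRes_nonneg e)]
    by_cases h : G.maxRes e = 0
    · simpa [h] using H.edgeEnergy_nonneg x e
    · rw [mul_div_cancel₀ _ h]

theorem edgeEnergy_eq_zero (hG : G.graph.Connected) {e : E} (he : G.maxRes e = 0) (x : V → ℝ) :
    H.edgeEnergy x e = 0 := by
  have h1 := G.edgeNorm_le e (G.graph.gradient x)
  rw [he, Real.sqrt_zero, zero_mul] at h1
  rw [← edgeNorm_gradient_sq hG, le_antisymm h1 (G.edgeNorm_nonneg _ _), sq, zero_mul]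

/-- When `p(e) = λ w(e) R^max(e)` is not capped and nonzero, both sides are the same expression. In
the other cases both vanish: a hyperedge with `p(e) = 1` keeps its weight, weight `0` stays `0`, and
`R^max(e) = 0` forces zero energy. -/
theorem weight_sub_mul_edgeEnergy (hG : G.graph.Connected) {lam : ℝ≥0}
    (hlam : (0 : ℝ) < lam) {s : E → Bool} {e : E} (hs : G.sampleProb lam e = 1 → s e = true)
    (x : V → ℝ) :
    ((G.sparsification lam s).weight e - H.weight e) * H.edgeEnergy x e * lam =
      (outcome (s e) - G.sampleProb lam e) * G.relNorm lam e (G.graph.gradient x) ^ 2 := by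
  have hw : (G.sparsification lam s).weight e =
      outcome (s e) * (H.weight e / G.sampleProb lam e) := by
    simp only [sparsification, outcome]
    split_ifs <;> simp
  rw [hw]
  by_cases h1 : G.sampleProb lam e = 1
  · simp [relNorm, h1, hs h1, outcome]
  by_cases h2 : H.weight e = 0
  · simp [relNorm, h2]
  by_cases h3 : G.maxRes e = 0
  · simp [relNorm, h3, edgeEnergy_eq_zero hG h3]
  have hp : (G.sampleProb lam e : ℝ) = H.weight e * G.maxRes e * lam := by
    refine min_eq_right (le_of_not_ge fun h => h1 ?_)
    exact Subtype.ext (min_eq_left h)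
  simp only [relNorm, h1, h2, or_self, if_false]
  rw [div_pow, edgeNorm_gradient_sq hG, Real.sq_sqrt (G.maxRes_nonneg e), hp]
  have h4 : (lam : ℝ) ≠ 0 := hlam.ne'
  field_simp

/-- Sparsification is certified by concentration of the normalized energies. -/
theorem isSpectralSparsifier_of_concentration (hG : G.graph.Connected) {lam : ℝ≥0} (hlam : 0 < lam)
    {ε : ℝ} {s : E → Bool} (hs : ∀ e, G.sampleProb lam e = 1 → s e = true)
    (hconc : ∀ z, ‖z‖ ≤ 1 → ∑ e, G.sampleProb lam e * G.relNorm lam e z ^ 2 ≤ (lam : ℝ) →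
      |∑ e, (outcome (s e) - G.sampleProb lam e) * G.relNorm lam e z ^ 2| ≤ ε * lam) :
    (G.sparsification lam s).IsSpectralSparsifier H ε := by
  refine ⟨rfl, fun x => ?_⟩
  have hlam' : (0 : ℝ) < lam := hlam
  set H' := G.sparsification lam s with hH'
  have hE' : ∀ x, H'.energy x = ∑ e, H'.weight e * H.edgeEnergy x e := fun x => rfl
  have hunit : ∀ x, H.energy x = 1 → |H'.energy x - 1| ≤ ε := by
    intro x hx
    have hz : ‖G.graph.gradient x‖ ≤ 1 := by
      have := G.norm_gradient_sq_le_energy x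
      rw [hx] at this
      exact (sq_le_one_iff₀ (norm_nonneg _)).mp this
    have hq : ∑ e, G.sampleProb lam e * G.relNorm lam e (G.graph.gradient x) ^ 2 ≤ (lam : ℝ) := by
      rw [← mul_one (lam : ℝ), ← hx, energy_eq, Finset.mul_sum]
      refine Finset.sum_le_sum fun e _ => ?_
      have h1 : (G.sampleProb lam e : ℝ) ≤ H.weight e * G.maxRes e * lam := min_le_right _ _
      have h2 := maxRes_mul_relNorm_sq_le hG lam e x
      have h3 := H.weight_nonneg e
      calc (G.sampleProb lam e : ℝ) * G.relNorm lam e (G.graph.gradient x) ^ 2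
          ≤ H.weight e * G.maxRes e * lam * G.relNorm lam e (G.graph.gradient x) ^ 2 := by gcongr
        _ = lam * (H.weight e * (G.maxRes e * G.relNorm lam e (G.graph.gradient x) ^ 2)) := by
            ring
        _ ≤ _ := by gcongr
    have h4 := hconc _ hz hq
    rw [Finset.sum_congr rfl fun e _ => (weight_sub_mul_edgeEnergy hG hlam' (hs e) x).symm,
      ← Finset.sum_mul, abs_mul, abs_of_pos hlam'] at h4
    have h5 := le_of_mul_le_mul_right h4 hlam'
    simp only [sub_mul, Finset.sum_sub_distrib] at h5
    rwa [← hH', ← hE', ← energy_eq, hx] at h5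
  suffices h : |H'.energy x - H.energy x| ≤ ε * H.energy x by
    obtain ⟨h1, h2⟩ := abs_le.mp h
    constructor <;> linarith
  -- Zero energy cannot be normalized, but then every term `w(e)` times hyperedge energy vanishes,
  -- and so does any rescaling of it.
  rcases (H.energy_nonneg x).eq_or_lt with h0 | h0
  · have h1 : ∀ e, H.weight e * H.edgeEnergy x e = 0 := fun e =>
      (Finset.sum_eq_zero_iff_of_nonneg fun e _ =>
        mul_nonneg (H.weight_nonneg e) (H.edgeEnergy_nonneg x e)).mp h0.symm e (Finset.mem_univ e)
    have h2 : H'.energy x = 0 := by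
      rw [hE']
      refine Finset.sum_eq_zero fun e _ => ?_
      simp only [hH', sparsification]
      split_ifs
      · rw [div_mul_eq_mul_div, h1, zero_div]
      · exact zero_mul _
    simp [h2, ← h0]
  · have hc : (√(H.energy x))⁻¹ ^ 2 = (H.energy x)⁻¹ := by
      rw [inv_pow, Real.sq_sqrt h0.le]
    have h1 := hunit ((√(H.energy x))⁻¹ • x) (by
      rw [energy_smul, hc, inv_mul_cancel₀ h0.ne'])
    rw [energy_smul, hc] at h1
    have h2 : H'.energy x - H.energy x = H.energy x * ((H.energy x)⁻¹ * H'.energy x - 1) := by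
      field_simp
    rw [h2, abs_mul, abs_of_pos h0, mul_comm ε]
    gcongr

end WeightAssignment

end WeightedHypergraph

end HypergraphSparsification

/-! ### The sparsification theorem -/

theorem mainTheorem3 :
    ∃ c : ℝ, 0 < c ∧ ∀ γ : ℝ, 4 ≤ γ → ∃ K : ℝ, 0 < K ∧
      ∀ (V E : Type*) [Fintype V] [DecidableEq V] [Fintype E]
        (H : HypergraphSparsification.WeightedHypergraph V E) (G : H.WeightAssignment)
        (ε : ℝ) (lam : ℝ≥0),
        G.graph.Connected →
        G.IsApproxBalanced (1 / (Fintype.card V : ℝ) ^ 2) γ →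
        1 / (Fintype.card V : ℝ) ≤ ε → ε < 1 →
        c * Real.log (Fintype.card V) ^ 3 / ε ^ 4 ≤ lam →
        1 - K * Real.log (Fintype.card V) / (Fintype.card V : ℝ) ≤
          (G.sampleLaw lam).real
            {s | (G.sparsification lam s).IsSpectralSparsifier H ε} := by
  -- In `K`, the `100` covers the failure probability when `γ ≤ n`; the `2γ` makes the bound vacuous
  -- when `γ > n`.
  refine ⟨10 ^ 10, by norm_num, fun γ hγ => ⟨100 + 2 * γ, by linarith, ?_⟩⟩
  intro V E _ _ _ H G ε lam hconn hbal hε0 hε1 hlam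
  have hne : Nonempty V := hconn.nonempty
  -- A single vertex would force `1 ≤ ε`.
  have hn : 2 ≤ Fintype.card V := by
    by_contra! hlt
    have h1 : Fintype.card V = 1 := le_antisymm (by omega) Fintype.card_pos
    rw [h1] at hε0
    norm_num at hε0
    linarith
  set n := Fintype.card V with hndef
  have hn2 : (2 : ℝ) ≤ n := by exact_mod_cast hn
  have hL : 0.69 ≤ Real.log n := by
    have := Real.log_le_log (by norm_num) hn2
    have := Real.log_two_gt_d9
    linarith
  by_cases hγn : γ ≤ n
  · have hε : 0 < ε := lt_of_lt_of_le (by positivity) hε0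
    have hlam0 : (0 : ℝ) < lam := lt_of_lt_of_le (by positivity) hlam
    have hp : ∑ e, (G.sampleProb lam e : ℝ) ≤ lam * (4 * γ * n) := by
      calc ∑ e, (G.sampleProb lam e : ℝ) ≤ ∑ e, H.weight e * G.maxRes e * lam :=
            Finset.sum_le_sum fun e _ => min_le_right _ _
        _ = lam * ∑ e, H.weight e * G.maxRes e := by rw [← Finset.sum_mul, mul_comm]
        _ ≤ lam * (4 * γ * n) := mul_le_mul_of_nonneg_left
            (G.sum_weight_mul_maxRes_le hn (by linarith) hbal) hlam0.le
    obtain ⟨B, hB1, hB2⟩ := HypergraphSparsification.sampling_concentration (G.sampleProb lam)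
      G.graph.norm_unitResVec_le (G.relNorm_nonneg lam) (G.relNorm_le_one lam)
      (G.abs_relNorm_sub_le lam) hn (by rw [Fintype.card_prod, sq]) hε0 hε1 (by linarith) hγn hp
      hlam
    have hsub : (B ∪ {s | ∃ e, G.sampleProb lam e = 1 ∧ s e = false})ᶜ ⊆
        {s | (G.sparsification lam s).IsSpectralSparsifier H ε} := by
      intro s hs
      rw [Set.mem_compl_iff, Set.mem_union, not_or] at hs
      refine HypergraphSparsification.WeightedHypergraph.WeightAssignment.isSpectralSparsifier_of_concentration
        hconn hlam0 (fun e he => ?_) (hB2 s hs.1)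
      by_contra h
      exact hs.2 ⟨e, he, by simpa using h⟩
    have h1 := measureReal_union_le (μ := HypergraphSparsification.bernoulliLaw (G.sampleProb lam))
      B {s | ∃ e, G.sampleProb lam e = 1 ∧ s e = false}
    rw [HypergraphSparsification.bernoulliLaw_sure, add_zero] at h1
    have h2 := measureReal_mono
      (μ := HypergraphSparsification.bernoulliLaw (G.sampleProb lam)) hsub
    rw [probReal_compl_eq_one_sub (Set.toFinite _).measurableSet] at h2
    -- `bernoulliLaw (G.sampleProb lam)` and `G.sampleLaw lam` agree by definition.
    refine le_trans ?_ h2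
    have h3 : 100 * Real.log n / n ≤ (100 + 2 * γ) * Real.log n / n := by
      gcongr
      linarith
    linarith
  -- Here `2γ log n ≥ n`, since `log n ≥ 0.69`, so the claimed lower bound is not positive.
  · refine le_trans ?_ measureReal_nonneg
    rw [sub_nonpos, one_le_div (by linarith)]
    push Not at hγn
    nlinarith
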